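/- Let $M$ be a non-empty closed $C^\infty$ manifold, let $S$ be a connected and simply connected solvable Lie group with Lie algebra $\mathfrak s$, and let $\rho_0\colon M\times S\to M$ be a $C^\infty$ right action that is locally free, that is, every isotropy subgroup is discrete in $S$. Let $\mathcal F$ be the foliation of $M$ by the orbits of $\rho_0$. The canonical $1$-form $\omega_0$ of $\rho_0$ is the leafwise $\mathfrak s$-valued $1$-form for which $(\omega_0)_x\colon T_x\mathcal F\to\mathfrak s$ is, for every $x\in M$, the inverse of the derivative at the identity of the map $S\to M$, $g\mapsto\rho_0(x,g)$. Let $\pi\colon\mathfrak s\to\operatorname{End}(V)$ be a representation of $\mathfrak s$ on a finite-dimensional real vector space $V$. Let $\Omega^p(\mathcal F;V)$ be the space of $C^\infty$ leafwise $V$-valued $p$-forms, and let $D\colon\Omega^p(\mathcal F;V)\to\Omega^{p+1}(\mathcal F;V)$ be the exterior derivative of the leafwise connection $\nabla_X\xi=X\xi+\pi(\omega_0(X))\xi$ on the trivial bundle $M\times V\to M$, that is, $$ (D\eta)(X_0,\dots,X_p)=\sum_{i}(-1)^i\,\nabla_{X_i}\bigl(\eta(X_0,\dots,\widehat{X_i},\dots,X_p)\bigr)+\sum_{i<j}(-1)^{i+j}\,\eta\bigl([X_i,X_j],X_0,\dots,\widehat{X_i},\dots,\widehat{X_j},\dots,X_p\bigr)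 $$ for all $C^\infty$ vector fields $X_0,\dots,X_p$ tangent to $\mathcal F$. Let $H^p(\mathcal F;\pi)$ be the quotient of $\{\eta\in\Omega^p(\mathcal F;V): D\eta=0\}$ by the image of $D$ in degree $p$ (by $0$ if $p=0$). Let $H^p(\mathfrak s;\pi)$ be the cohomology of the Lie algebra $\mathfrak s$ with coefficients in $\pi$, that is, the cohomology of the complex $\operatorname{Hom}(\bigwedge^*\mathfrak s,V)$ with the Chevalley–Eilenberg differential (the same formula, with $X_0,\dots,X_p\in\mathfrak s$ and with $\pi(X_i)$ in place of $\nabla_{X_i}$). For $\varphi\in\operatorname{Hom}(\bigwedge^p\mathfrak s,V)$ let $\omega_0^*\varphi\in\Omega^p(\mathcal F;V)$ be the pullback $$ (\omega_0^*\varphi)_x(v_1,\dots,v_p)=\varphi\bigl((\omega_0)_x(v_1),\dots,(\omega_0)_x(v_p)\bigr),\qquad v_1,\dots,v_p\in T_x\mathcal F . $$ Then, for every $p\ge 0$, the form $\omega_0^*\varphi$ is $D$-closed whenever $\varphi$ is a cocycle, and $[\varphi]\mapsto[\omega_0^*\varphi]$ is a well-defined linear map $$ H^p(\mathfrak s;\pi)\longrightarrow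 H^p(\mathcal F;\pi), $$ and this map is injective. -/

import Mathlib

set_option linter.unusedSectionVars false

open scoped Manifold ContDiff Topology

namespace LeafwiseCohomology

section Preliminaries

open Bundle VectorField

variable {E : Type*} [NormedAddCommGroup E] [NormedSpace ℝ E]
  {F : Type*} [NormedAddCommGroup F] [NormedSpace ℝ F]
  {M : Type*} [TopologicalSpace M] [ChartedSpace E M]
  {S : Type*} [TopologicalSpace S] [ChartedSpace F S]

/-! ### Brackets of related vector fields -/

theorem fderiv_lieBracket_of_related {f : F → E} {x : F} (hf : ContDiffAt ℝ ∞ f x)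
    {V W : F → F} {V' W' : E → E} (hV : DifferentiableAt ℝ V x) (hW : DifferentiableAt ℝ W x)
    (hV' : DifferentiableAt ℝ V' (f x)) (hW' : DifferentiableAt ℝ W' (f x))
    (hVV : ∀ᶠ y in 𝓝 x, fderiv ℝ f y (V y) = V' (f y))
    (hWW : ∀ᶠ y in 𝓝 x, fderiv ℝ f y (W y) = W' (f y)) :
    fderiv ℝ f x (lieBracket ℝ V W x) = lieBracket ℝ V' W' (f x) := by
  have hfd : DifferentiableAt ℝ f x := hf.differentiableAt (by simp)
  rw [fderiv_apply_lieBracket (hf.of_le (ENat.LEInfty.out : (2 : WithTop ℕ∞) ≤ ∞))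
    (by simp) hW hV, Filter.EventuallyEq.fderiv_eq hVV,
    Filter.EventuallyEq.fderiv_eq hWW]
  change fderiv ℝ (W' ∘ f) x (V x) - fderiv ℝ (V' ∘ f) x (W x) = _
  rw [fderiv_comp _ hW' hfd, fderiv_comp _ hV' hfd]
  simp only [ContinuousLinearMap.comp_apply, hVV.self_of_nhds, hWW.self_of_nhds]
  rfl

theorem mlieBracket_eq_lieBracket [IsManifold 𝓘(ℝ, E) ∞ M] (V W : Π x : M, TangentSpace 𝓘(ℝ, E) x)
    (x : M) :
    mlieBracket 𝓘(ℝ, E) V W x = lieBracket ℝ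
      (mpullbackWithin 𝓘(ℝ, E) 𝓘(ℝ, E) (extChartAt 𝓘(ℝ, E) x).symm V (Set.range 𝓘(ℝ, E)))
      (mpullbackWithin 𝓘(ℝ, E) 𝓘(ℝ, E) (extChartAt 𝓘(ℝ, E) x).symm W (Set.range 𝓘(ℝ, E)))
      (extChartAt 𝓘(ℝ, E) x x) := by
  have hid : mfderiv 𝓘(ℝ, E) 𝓘(ℝ, E) (extChartAt 𝓘(ℝ, E) x) x = ContinuousLinearMap.id ℝ E :=
    mfderiv_extChartAt_self
  have hs : ((extChartAt 𝓘(ℝ, E) x).symm ⁻¹' Set.univ ∩ Set.range 𝓘(ℝ, E) : Set E) = Set.univ := by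
    simp
  rw [← mlieBracketWithin_univ, mlieBracketWithin_apply, hs]
  refine (congrArg (fun T : E →L[ℝ] E => T.inverse (lieBracketWithin ℝ
    (mpullbackWithin 𝓘(ℝ, E) 𝓘(ℝ, E) (extChartAt 𝓘(ℝ, E) x).symm V (Set.range 𝓘(ℝ, E)))
    (mpullbackWithin 𝓘(ℝ, E) 𝓘(ℝ, E) (extChartAt 𝓘(ℝ, E) x).symm W (Set.range 𝓘(ℝ, E)))
    Set.univ (extChartAt 𝓘(ℝ, E) x x))) hid).trans ?_
  rw [ContinuousLinearMap.inverse_id]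
  exact congrFun lieBracketWithin_univ (extChartAt 𝓘(ℝ, E) x x)

/-- Vector fields on `S` and `M` that are related by a smooth map have related brackets. -/
theorem mfderiv_mlieBracket_of_related [FiniteDimensional ℝ E] [FiniteDimensional ℝ F]
    [IsManifold 𝓘(ℝ, E) ∞ M] [IsManifold 𝓘(ℝ, F) ∞ S] {f : S → M}
    (hf : ContMDiff 𝓘(ℝ, F) 𝓘(ℝ, E) ∞ f)
    {V W : Π x : S, TangentSpace 𝓘(ℝ, F) x} {V' W' : Π x : M, TangentSpace 𝓘(ℝ, E) x} (x : S)
    (hV : MDifferentiableAt 𝓘(ℝ, F) (𝓘(ℝ, F).prod 𝓘(ℝ, F))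
      (fun x => (⟨x, V x⟩ : TangentBundle 𝓘(ℝ, F) S)) x)
    (hW : MDifferentiableAt 𝓘(ℝ, F) (𝓘(ℝ, F).prod 𝓘(ℝ, F))
      (fun x => (⟨x, W x⟩ : TangentBundle 𝓘(ℝ, F) S)) x)
    (hV' : MDifferentiableAt 𝓘(ℝ, E) (𝓘(ℝ, E).prod 𝓘(ℝ, E))
      (fun x => (⟨x, V' x⟩ : TangentBundle 𝓘(ℝ, E) M)) (f x))
    (hW' : MDifferentiableAt 𝓘(ℝ, E) (𝓘(ℝ, E).prod 𝓘(ℝ, E))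
      (fun x => (⟨x, W' x⟩ : TangentBundle 𝓘(ℝ, E) M)) (f x))
    (hVV : ∀ y, mfderiv 𝓘(ℝ, F) 𝓘(ℝ, E) f y (V y) = V' (f y))
    (hWW : ∀ y, mfderiv 𝓘(ℝ, F) 𝓘(ℝ, E) f y (W y) = W' (f y)) :
    mfderiv 𝓘(ℝ, F) 𝓘(ℝ, E) f x (mlieBracket 𝓘(ℝ, F) V W x) =
      mlieBracket 𝓘(ℝ, E) V' W' (f x) := by
  have hc := (contMDiffAt_iff.1 (hf x)).2
  simp only [modelWithCornersSelf_coe, Set.range_id, contDiffWithinAt_univ] at hc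
  set φ := extChartAt 𝓘(ℝ, F) x with hφ
  set ψ := extChartAt 𝓘(ℝ, E) (f x) with hψ
  have hfx : (ψ ∘ f ∘ φ.symm) (φ x) = ψ (f x) := by simp [hφ]
  have hrel : ∀ (U : Π x : S, TangentSpace 𝓘(ℝ, F) x) (U' : Π x : M, TangentSpace 𝓘(ℝ, E) x),
      (∀ y, mfderiv 𝓘(ℝ, F) 𝓘(ℝ, E) f y (U y) = U' (f y)) →
      ∀ᶠ y in 𝓝 (φ x), fderiv ℝ (ψ ∘ f ∘ φ.symm) y
        (mpullbackWithin 𝓘(ℝ, F) 𝓘(ℝ, F) φ.symm U (Set.range 𝓘(ℝ, F)) y) =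
        mpullbackWithin 𝓘(ℝ, E) 𝓘(ℝ, E) ψ.symm U' (Set.range 𝓘(ℝ, E)) ((ψ ∘ f ∘ φ.symm) y) := by
    intro U U' hU
    have h1 : ∀ᶠ y in 𝓝 (φ x), y ∈ φ.target := extChartAt_target_mem_nhds x
    have h2 : ∀ᶠ y in 𝓝 (φ x), f (φ.symm y) ∈ ψ.source := by
      have hcont : ContinuousAt (f ∘ φ.symm) (φ x) := by
        refine ContinuousAt.comp ?_ (continuousAt_extChartAt_symm x)
        exact hf.continuous.continuousAt
      refine hcont.eventually ?_
      have := extChartAt_source_mem_nhds (I := 𝓘(ℝ, E)) (f x)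
      rw [Function.comp_apply, hφ, extChartAt_to_inv x]
      exact this
    filter_upwards [h1, h2] with y hy1 hy2
    have hy3 : f (φ.symm y) ∈ (chartAt E (f x)).source := by
      rwa [hψ, extChartAt_source] at hy2
    have hinvS := isInvertible_mfderivWithin_extChartAt_symm (I := 𝓘(ℝ, F)) hy1
    have hinvM := isInvertible_mfderivWithin_extChartAt_symm (I := 𝓘(ℝ, E)) (ψ.map_source hy2)
    have hu : mfderivWithin 𝓘(ℝ, F) 𝓘(ℝ, F) φ.symm (Set.range 𝓘(ℝ, F)) y
        (mpullbackWithin 𝓘(ℝ, F) 𝓘(ℝ, F) φ.symm U (Set.range 𝓘(ℝ, F)) y) = U (φ.symm y) :=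
      hinvS.self_apply_inverse _
    have hu' : mfderivWithin 𝓘(ℝ, E) 𝓘(ℝ, E) ψ.symm (Set.range 𝓘(ℝ, E)) (ψ (f (φ.symm y)))
        (mpullbackWithin 𝓘(ℝ, E) 𝓘(ℝ, E) ψ.symm U' (Set.range 𝓘(ℝ, E)) (ψ (f (φ.symm y)))) =
          U' (ψ.symm (ψ (f (φ.symm y)))) :=
      hinvM.self_apply_inverse _
    generalize mpullbackWithin 𝓘(ℝ, F) 𝓘(ℝ, F) φ.symm U (Set.range 𝓘(ℝ, F)) y = u at hu ⊢
    have hd : fderiv ℝ (ψ ∘ f ∘ φ.symm) y u =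
        mfderiv 𝓘(ℝ, E) 𝓘(ℝ, E) ψ (f (φ.symm y)) (U' (f (φ.symm y))) := by
      have hφd : MDifferentiableAt 𝓘(ℝ, F) 𝓘(ℝ, F) φ.symm y := by
        have := mdifferentiableWithinAt_extChartAt_symm (I := 𝓘(ℝ, F)) hy1
        rwa [modelWithCornersSelf_coe, Set.range_id, mdifferentiableWithinAt_univ] at this
      have hfd : MDifferentiableAt 𝓘(ℝ, F) 𝓘(ℝ, E) f (φ.symm y) :=
        hf.mdifferentiable (by simp) _
      have hψd : MDifferentiableAt 𝓘(ℝ, E) 𝓘(ℝ, E) ψ (f (φ.symm y)) :=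
        mdifferentiableAt_extChartAt hy3
      rw [modelWithCornersSelf_coe, Set.range_id, mfderivWithin_univ] at hu
      rw [← mfderiv_eq_fderiv, mfderiv_comp y hψd (hfd.comp y hφd), mfderiv_comp y hfd hφd]
      change mfderiv 𝓘(ℝ, E) 𝓘(ℝ, E) ψ (f (φ.symm y)) (mfderiv 𝓘(ℝ, F) 𝓘(ℝ, E) f (φ.symm y)
        (mfderiv 𝓘(ℝ, F) 𝓘(ℝ, F) φ.symm y u)) = _
      rw [hu, hU]
    rw [hd]
    apply hinvM.injective
    refine Eq.trans ?_ hu'.symm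
    have hcomp := mfderivWithin_extChartAt_symm_comp_mfderiv_extChartAt' (I := 𝓘(ℝ, E)) hy2
    have hcomp' := congrArg (fun T : E →L[ℝ] E => T (U' (f (φ.symm y)))) hcomp
    refine Eq.trans hcomp' ?_
    have hval : ∀ p q : M, p = q → (U' p : E) = U' q := by
      rintro p q rfl
      rfl
    exact hval _ _ (ψ.left_inv hy2).symm
  have hpb : ∀ (x : S) {U : Π x : S, TangentSpace 𝓘(ℝ, F) x},
      MDifferentiableAt 𝓘(ℝ, F) (𝓘(ℝ, F).prod 𝓘(ℝ, F))
        (fun x => (⟨x, U x⟩ : TangentBundle 𝓘(ℝ, F) S)) x →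
      DifferentiableAt ℝ (mpullbackWithin 𝓘(ℝ, F) 𝓘(ℝ, F) (extChartAt 𝓘(ℝ, F) x).symm U
        (Set.range 𝓘(ℝ, F))) (extChartAt 𝓘(ℝ, F) x x) := by
    intro x U hU
    rw [← mdifferentiableWithinAt_univ] at hU
    have := hU.differentiableWithinAt_mpullbackWithin_vectorField
    rw [modelWithCornersSelf_coe, Set.range_id, Set.preimage_univ, Set.univ_inter] at this
    rw [modelWithCornersSelf_coe, Set.range_id]
    exact differentiableWithinAt_univ.1 this
  have hpb' : ∀ (x : M) {U : Π x : M, TangentSpace 𝓘(ℝ, E) x},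
      MDifferentiableAt 𝓘(ℝ, E) (𝓘(ℝ, E).prod 𝓘(ℝ, E))
        (fun x => (⟨x, U x⟩ : TangentBundle 𝓘(ℝ, E) M)) x →
      DifferentiableAt ℝ (mpullbackWithin 𝓘(ℝ, E) 𝓘(ℝ, E) (extChartAt 𝓘(ℝ, E) x).symm U
        (Set.range 𝓘(ℝ, E))) (extChartAt 𝓘(ℝ, E) x x) := by
    intro x U hU
    rw [← mdifferentiableWithinAt_univ] at hU
    have := hU.differentiableWithinAt_mpullbackWithin_vectorField
    rw [modelWithCornersSelf_coe, Set.range_id, Set.preimage_univ, Set.univ_inter] at this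
    rw [modelWithCornersSelf_coe, Set.range_id]
    exact differentiableWithinAt_univ.1 this
  have key := fderiv_lieBracket_of_related hc
    (V := mpullbackWithin 𝓘(ℝ, F) 𝓘(ℝ, F) φ.symm V (Set.range 𝓘(ℝ, F)))
    (W := mpullbackWithin 𝓘(ℝ, F) 𝓘(ℝ, F) φ.symm W (Set.range 𝓘(ℝ, F)))
    (V' := mpullbackWithin 𝓘(ℝ, E) 𝓘(ℝ, E) ψ.symm V' (Set.range 𝓘(ℝ, E)))
    (W' := mpullbackWithin 𝓘(ℝ, E) 𝓘(ℝ, E) ψ.symm W' (Set.range 𝓘(ℝ, E)))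
    (hpb x hV) (hpb x hW) (by rw [hfx]; exact hpb' (f x) hV') (by rw [hfx]; exact hpb' (f x) hW')
    (hrel V V' hVV) (hrel W W' hWW)
  rw [hfx] at key
  have hbS := mlieBracket_eq_lieBracket V W x
  have hbM := mlieBracket_eq_lieBracket V' W' (f x)
  have hdf : mfderiv 𝓘(ℝ, F) 𝓘(ℝ, E) f x = fderiv ℝ (ψ ∘ f ∘ φ.symm) (φ x) := by
    rw [(hf.mdifferentiable (by simp) x).mfderiv, modelWithCornersSelf_coe, Set.range_id,
      fderivWithin_univ]
    rfl
  rw [hdf, hbS, hbM]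
  exact key

/-! ### Smooth right actions -/

/-- A `C^∞` right action of the Lie group `S` on the manifold `M`. -/
structure SmoothRightAction (E F M S : Type*) [NormedAddCommGroup E] [NormedSpace ℝ E]
    [NormedAddCommGroup F] [NormedSpace ℝ F] [TopologicalSpace M] [ChartedSpace E M]
    [TopologicalSpace S] [ChartedSpace F S] [Group S] where
  /-- The action map `(x, g) ↦ x · g`. -/
  act : M → S → M
  act_one : ∀ x, act x 1 = x
  act_mul : ∀ x g h, act x (g * h) = act (act x g) h
  smooth : ContMDiff (𝓘(ℝ, E).prod 𝓘(ℝ, F)) 𝓘(ℝ, E) ∞ (fun q : M × S => act q.1 q.2)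

namespace SmoothRightAction

section Basic

variable [Group S] (ρ : SmoothRightAction E F M S)

/-- The isotropy subgroup of the point `x`. -/
def isotropy (x : M) : Subgroup S where
  carrier := {g | ρ.act x g = x}
  one_mem' := ρ.act_one x
  mul_mem' := by
    intro g h hg hh
    simp only [Set.mem_ofPred_eq] at *
    rw [ρ.act_mul, hg, hh]
  inv_mem' := by
    intro g hg
    simp only [Set.mem_ofPred_eq] at *
    conv_lhs => rw [← hg]
    rw [← ρ.act_mul, mul_inv_cancel, ρ.act_one]

/-- The action is locally free: every isotropy subgroup is discrete. -/
def LocallyFree : Prop := ∀ x, DiscreteTopology (ρ.isotropy x)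

/-- The derivative at the identity of the orbit map `g ↦ x · g`, from the Lie algebra to `T_x M`
(recall that `x · 1 = x`). -/
noncomputable def orbitDeriv (x : M) : GroupLieAlgebra 𝓘(ℝ, F) S →L[ℝ] TangentSpace 𝓘(ℝ, E) x :=
  mfderiv 𝓘(ℝ, F) 𝓘(ℝ, E) (fun g => ρ.act x g) 1

theorem smooth_orbit (x : M) : ContMDiff 𝓘(ℝ, F) 𝓘(ℝ, E) ∞ (fun g => ρ.act x g) :=
  ρ.smooth.comp (contMDiff_const.prodMk contMDiff_id)

theorem symmL_one_eq [LieGroup 𝓘(ℝ, F) ∞ S] (v : F) :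
    ((trivializationAt F (TangentSpace 𝓘(ℝ, F)) (1 : S)).symmL ℝ (1 : S) v : F) = v := by
  rw [TangentBundle.symmL_trivializationAt_eq_core (mem_chart_source _ _)]
  exact (tangentBundleCore 𝓘(ℝ, F) S).coordChange_self _ _ (mem_achart_source F 1) v

/-- The orbit derivative in the trivialisation at `x₀` of the tangent bundle. -/
noncomputable def orbitDerivCoord [IsManifold 𝓘(ℝ, E) ∞ M] (x₀ x : M) : F →L[ℝ] E :=
  (trivializationAt E (TangentSpace 𝓘(ℝ, E)) x₀).continuousLinearMapAt ℝ x ∘L (ρ.orbitDeriv x)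

theorem orbitDerivCoord_apply [IsManifold 𝓘(ℝ, E) ∞ M] (x₀ x : M) (v : F) :
    ρ.orbitDerivCoord x₀ x v =
      (trivializationAt E (TangentSpace 𝓘(ℝ, E)) x₀).continuousLinearMapAt ℝ x
        (ρ.orbitDeriv x v) := rfl

end Basic

section Smoothness

variable [Group S] (ρ : SmoothRightAction E F M S)
  [IsManifold 𝓘(ℝ, E) ∞ M] [LieGroup 𝓘(ℝ, F) ∞ S]

theorem smooth_orbitDerivCoord (x₀ : M) :
    ContMDiffAt 𝓘(ℝ, E) 𝓘(ℝ, F →L[ℝ] E) ∞ (ρ.orbitDerivCoord x₀) x₀ := by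
  have h := ContMDiffAt.mfderiv (I := 𝓘(ℝ, F)) (I' := 𝓘(ℝ, E)) (J := 𝓘(ℝ, E)) (m := ∞) (n := ∞)
    (x₀ := x₀) (fun x g => ρ.act x g) (fun _ => (1 : S)) (ρ.smooth _) contMDiffAt_const (by simp)
  have hT : ∀ (a b x : M), a = x₀ → b = x → ∀ w : E,
      (trivializationAt E (TangentSpace 𝓘(ℝ, E)) a).continuousLinearMapAt ℝ b w =
        (trivializationAt E (TangentSpace 𝓘(ℝ, E)) x₀).continuousLinearMapAt ℝ x w := by
    rintro a b x rfl rfl w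
    rfl
  refine h.congr_of_eventuallyEq (Filter.Eventually.of_forall fun x => ?_)
  ext v
  change _ = (trivializationAt E (TangentSpace 𝓘(ℝ, E)) (ρ.act x₀ 1)).continuousLinearMapAt ℝ
    (ρ.act x 1) (ρ.orbitDeriv x
      ((trivializationAt F (TangentSpace 𝓘(ℝ, F)) (1 : S)).symmL ℝ (1 : S) v : F))
  rw [symmL_one_eq]
  exact (hT _ _ x (ρ.act_one _) (ρ.act_one _) _).symm

/-- Combining the fundamental vector fields with smooth coefficients gives a smooth field. -/
theorem smooth_combination {a : M → F} {x₀ : M} (ha : ContMDiffAt 𝓘(ℝ, E) 𝓘(ℝ, F) ∞ a x₀) :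
    ContMDiffAt 𝓘(ℝ, E) (𝓘(ℝ, E).prod 𝓘(ℝ, E)) ∞
      (fun x => (⟨x, ρ.orbitDeriv x (a x)⟩ : TangentBundle 𝓘(ℝ, E) M)) x₀ := by
  rw [contMDiffAt_section]
  have h := (ρ.smooth_orbitDerivCoord x₀).clm_apply ha
  refine h.congr_of_eventuallyEq ?_
  have hb := (trivializationAt E (TangentSpace 𝓘(ℝ, E)) x₀).open_baseSet.mem_nhds
    (FiberBundle.mem_baseSet_trivializationAt' x₀)
  filter_upwards [hb] with x hx
  rw [orbitDerivCoord_apply,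
    Trivialization.continuousLinearMapAt_apply_of_mem _ _ hx]

/-- The coefficients of a smooth combination of pointwise independent fundamental fields are
smooth. -/
theorem smooth_coefficients [FiniteDimensional ℝ E] [FiniteDimensional ℝ F] {a : M → F} {x₀ : M}
    (hinj : Function.Injective (ρ.orbitDeriv x₀))
    (ha : ContMDiffAt 𝓘(ℝ, E) (𝓘(ℝ, E).prod 𝓘(ℝ, E)) ∞
      (fun x => (⟨x, ρ.orbitDeriv x (a x)⟩ : TangentBundle 𝓘(ℝ, E) M)) x₀) :
    ContMDiffAt 𝓘(ℝ, E) 𝓘(ℝ, F) ∞ a x₀ := by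
  rw [contMDiffAt_section] at ha
  have hb := (trivializationAt E (TangentSpace 𝓘(ℝ, E)) x₀).open_baseSet.mem_nhds
    (FiberBundle.mem_baseSet_trivializationAt' x₀)
  have hX : ContMDiffAt 𝓘(ℝ, E) 𝓘(ℝ, E) ∞ (fun x => ρ.orbitDerivCoord x₀ x (a x)) x₀ := by
    refine ha.congr_of_eventuallyEq ?_
    filter_upwards [hb] with x hx
    rw [orbitDerivCoord_apply,
      Trivialization.continuousLinearMapAt_apply_of_mem _ _ hx]
  have hinj' : Function.Injective (ρ.orbitDerivCoord x₀ x₀) := by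
    intro v w hvw
    apply hinj
    have hx := FiberBundle.mem_baseSet_trivializationAt E (TangentSpace 𝓘(ℝ, E)) x₀
    rw [orbitDerivCoord_apply, orbitDerivCoord_apply] at hvw
    have := congrArg
      ((trivializationAt E (TangentSpace 𝓘(ℝ, E)) x₀).symmL ℝ x₀) hvw
    rwa [Trivialization.symmL_continuousLinearMapAt _ hx,
      Trivialization.symmL_continuousLinearMapAt _ hx] at this
  obtain ⟨L, hL⟩ := ContinuousLinearMap.HasLeftInverse.of_injective_of_finiteDimensional hinj'
  have hLA : ContMDiffAt 𝓘(ℝ, E) 𝓘(ℝ, F →L[ℝ] F) ∞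
      (fun x => L ∘L ρ.orbitDerivCoord x₀ x) x₀ :=
    contMDiffAt_const.clm_comp (ρ.smooth_orbitDerivCoord x₀)
  have hone : L ∘L ρ.orbitDerivCoord x₀ x₀ = ContinuousLinearMap.id ℝ F := by
    ext v
    exact hL v
  have hinv : (L ∘L ρ.orbitDerivCoord x₀ x₀).IsInvertible :=
    ⟨ContinuousLinearEquiv.refl ℝ F, by rw [hone]; rfl⟩
  have hR : ContMDiffAt 𝓘(ℝ, E) 𝓘(ℝ, F →L[ℝ] F) ∞
      (fun x => (L ∘L ρ.orbitDerivCoord x₀ x).inverse) x₀ :=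
    (hinv.contDiffAt_map_inverse).contMDiffAt.comp x₀ hLA
  have hev : ∀ᶠ x in 𝓝 x₀, (L ∘L ρ.orbitDerivCoord x₀ x).IsInvertible := by
    have h1 := (ContinuousLinearEquiv.refl ℝ F).nhds
    have h2 : Filter.Tendsto (fun x => L ∘L ρ.orbitDerivCoord x₀ x) (𝓝 x₀)
        (𝓝 ((ContinuousLinearEquiv.refl ℝ F : F ≃L[ℝ] F) : F →L[ℝ] F)) := by
      have h3 := hLA.continuousAt.tendsto
      rw [hone] at h3
      exact h3
    filter_upwards [h2 h1] with x hx
    exact hx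
  have hfin := hR.clm_apply (ContMDiffAt.clm_apply (contMDiffAt_const (c := L)) hX)
  refine hfin.congr_of_eventuallyEq ?_
  filter_upwards [hev] with x hx
  obtain ⟨e, he⟩ := hx
  change a x = (L ∘L ρ.orbitDerivCoord x₀ x).inverse ((L ∘L ρ.orbitDerivCoord x₀ x) (a x))
  rw [← he, ContinuousLinearMap.inverse_equiv]
  exact (e.symm_apply_apply _).symm

/-- The derivative of an orbit map on a left invariant vector field. -/
theorem mfderiv_orbit_mulInvariant (x : M) (g : S) (v : GroupLieAlgebra 𝓘(ℝ, F) S) :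
    (mfderiv 𝓘(ℝ, F) 𝓘(ℝ, E) (fun h => ρ.act x h) g (mulInvariantVectorField v g) : E) =
      ρ.orbitDeriv (ρ.act x g) v := by
  have hcomp : (fun h => ρ.act (ρ.act x g) h) = (fun h => ρ.act x h) ∘ (fun h => g * h) := by
    funext h
    exact (ρ.act_mul x g h).symm
  have h1 : MDifferentiableAt 𝓘(ℝ, F) 𝓘(ℝ, F) (fun h => g * h) (1 : S) :=
    (contMDiff_mul_left (I := 𝓘(ℝ, F)) (n := ∞)).mdifferentiable (by simp) _
  have h2 : MDifferentiableAt 𝓘(ℝ, F) 𝓘(ℝ, E) (fun h => ρ.act x h) (g * 1) :=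
    (ρ.smooth_orbit x).mdifferentiable (by simp) _
  have hval : ∀ h : S, h = g → ∀ w : F,
      (mfderiv 𝓘(ℝ, F) 𝓘(ℝ, E) (fun h => ρ.act x h) h w : E) =
        mfderiv 𝓘(ℝ, F) 𝓘(ℝ, E) (fun h => ρ.act x h) g w := by
    rintro h rfl w
    rfl
  unfold orbitDeriv
  rw [hcomp, mfderiv_comp (1 : S) h2 h1]
  exact (hval _ (mul_one g) _).symm

/-- Right translations of the group on itself. -/
def translation (S : Type*) [TopologicalSpace S] [ChartedSpace F S] [Group S]
    [LieGroup 𝓘(ℝ, F) ∞ S] : SmoothRightAction F F S S where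
  act x g := x * g
  act_one := mul_one
  act_mul x g h := (mul_assoc x g h).symm
  smooth := contMDiff_mul 𝓘(ℝ, F) ∞

theorem mulInvariantVectorField_one (v : GroupLieAlgebra 𝓘(ℝ, F) S) :
    (mulInvariantVectorField v (1 : S) : F) = v := by
  have h : (fun h : S => 1 * h) = id := by
    funext h
    exact one_mul h
  change (mfderiv 𝓘(ℝ, F) 𝓘(ℝ, F) (fun h : S => 1 * h) 1 v : F) = v
  rw [h, mfderiv_id]
  rfl

/-- For a locally free action the derivatives of the orbit maps are injective. -/
theorem orbitDeriv_injective [FiniteDimensional ℝ E] [FiniteDimensional ℝ F] (hρ : ρ.LocallyFree)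
    (x : M) : Function.Injective (ρ.orbitDeriv x) := by
  rw [injective_iff_map_eq_zero]
  intro v hv
  have : IsManifold 𝓘(ℝ, F) 1 S := .of_le (n := ∞) (by simp)
  have : IsManifold 𝓘(ℝ, E) 1 M := .of_le (n := ∞) (by simp)
  have hsm : ContMDiffAt 𝓘(ℝ, F) (𝓘(ℝ, F).prod 𝓘(ℝ, F)) 1
      (fun g : S => (⟨g, mulInvariantVectorField v g⟩ : TangentBundle 𝓘(ℝ, F) S)) 1 :=
    ((translation (F := F) S).smooth_combination (a := fun _ => v) contMDiffAt_const).of_le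
      (by simp)
  obtain ⟨γ, hγ0, hγ⟩ := exists_isMIntegralCurveAt_of_contMDiffAt_boundaryless 0 hsm
  have hfund : ContMDiffAt 𝓘(ℝ, E) (𝓘(ℝ, E).prod 𝓘(ℝ, E)) 1
      (fun y : M => (⟨y, ρ.orbitDeriv y v⟩ : TangentBundle 𝓘(ℝ, E) M)) x :=
    (ρ.smooth_combination (a := fun _ => v) contMDiffAt_const).of_le (by simp)
  have hδ : IsMIntegralCurveAt (fun t => ρ.act x (γ t))
      (fun y => (ρ.orbitDeriv y v : TangentSpace 𝓘(ℝ, E) y)) 0 := by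
    filter_upwards [hγ] with t ht
    have hd := ((ρ.smooth_orbit x).mdifferentiable (by simp) (γ t)).hasMFDerivAt.comp t ht
    refine hd.congr_mfderiv ?_
    refine ContinuousLinearMap.ext fun (r : ℝ) => ?_
    have hlin := (mfderiv 𝓘(ℝ, F) 𝓘(ℝ, E) (fun h => ρ.act x h) (γ t)).map_smul r
      (mulInvariantVectorField v (γ t))
    refine Eq.trans hlin ?_
    exact congrArg (fun w : E => r • w) (ρ.mfderiv_orbit_mulInvariant x (γ t) v)
  have hconst : IsMIntegralCurveAt (fun _ : ℝ => x)
      (fun y => (ρ.orbitDeriv y v : TangentSpace 𝓘(ℝ, E) y)) 0 := by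
    refine Filter.Eventually.of_forall fun t => ?_
    refine (hasMFDerivAt_const x t).congr_mfderiv ?_
    refine ContinuousLinearMap.ext fun (r : ℝ) => ?_
    have h0 : r • (0 : E) = 0 := smul_zero r
    exact ((congrArg (fun w : E => r • w) hv).trans h0).symm
  have heq : (fun t => ρ.act x (γ t)) =ᶠ[𝓝 0] fun _ => x := by
    have h0 : ρ.act x (γ 0) = x := by rw [hγ0, ρ.act_one]
    refine isMIntegralCurveAt_eventuallyEq_of_contMDiffAt_boundaryless ?_ hδ hconst h0
    rw [h0]
    exact hfund
  have hγ1 : ∀ᶠ t in 𝓝 0, γ t = 1 := by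
    have hdisc := hρ x
    have hopen : IsOpen ({1} : Set (ρ.isotropy x)) := isOpen_discrete _
    obtain ⟨U, hU, hU1⟩ := isOpen_induced_iff.1 hopen
    have h1U : (1 : S) ∈ U := by
      have : (1 : ρ.isotropy x) ∈ Subtype.val ⁻¹' U := by rw [hU1]; rfl
      exact this
    have hcont : ContinuousAt γ 0 := hγ.continuousAt
    have hUn : U ∈ 𝓝 (γ 0) := by
      rw [hγ0]
      exact hU.mem_nhds h1U
    filter_upwards [hcont hUn, heq] with t ht1 ht2
    have : (⟨γ t, ht2⟩ : ρ.isotropy x) ∈ ({1} : Set (ρ.isotropy x)) := by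
      rw [← hU1]
      exact ht1
    exact congrArg Subtype.val this
  have hd0 := hγ.self_of_nhds
  have hd1 : HasMFDerivAt 𝓘(ℝ, ℝ) 𝓘(ℝ, F) γ 0 0 :=
    (hasMFDerivAt_const (1 : S) (0 : ℝ)).congr_of_eventuallyEq hγ1
  have hz := congrArg (fun T : ℝ →L[ℝ] F => T 1) (hasMFDerivAt_unique hd0 hd1)
  have hz' : (1 : ℝ) • (mulInvariantVectorField v (γ 0) : F) = 0 := hz
  rw [one_smul] at hz'
  have hval : ∀ g : S, g = 1 → (mulInvariantVectorField v g : F) = v := by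
    rintro g rfl
    exact mulInvariantVectorField_one v
  rw [← hval _ hγ0]
  exact hz'

/-- Smooth vector fields `x ↦ dρ_x(a x)`, `x ↦ dρ_x(b x)` tangent to the orbits have a bracket
tangent to the orbits. -/
theorem mlieBracket_mem_range [FiniteDimensional ℝ E] [FiniteDimensional ℝ F]
    (hρ : ρ.LocallyFree) (a b : M → F)
    (ha : ContMDiff 𝓘(ℝ, E) (𝓘(ℝ, E).prod 𝓘(ℝ, E)) ∞
      (fun x => (⟨x, ρ.orbitDeriv x (a x)⟩ : TangentBundle 𝓘(ℝ, E) M)))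
    (hb : ContMDiff 𝓘(ℝ, E) (𝓘(ℝ, E).prod 𝓘(ℝ, E)) ∞
      (fun x => (⟨x, ρ.orbitDeriv x (b x)⟩ : TangentBundle 𝓘(ℝ, E) M))) (x : M) :
    mlieBracket 𝓘(ℝ, E) (fun x => ρ.orbitDeriv x (a x)) (fun x => ρ.orbitDeriv x (b x)) x ∈
      LinearMap.range (ρ.orbitDeriv x).toLinearMap := by
  have lift : ∀ c : M → F,
      ContMDiff 𝓘(ℝ, E) (𝓘(ℝ, E).prod 𝓘(ℝ, E)) ∞
        (fun x => (⟨x, ρ.orbitDeriv x (c x)⟩ : TangentBundle 𝓘(ℝ, E) M)) →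
      MDifferentiableAt 𝓘(ℝ, F) (𝓘(ℝ, F).prod 𝓘(ℝ, F))
        (fun g : S => (⟨g, mulInvariantVectorField (c (ρ.act x g)) g⟩ :
          TangentBundle 𝓘(ℝ, F) S)) 1 := by
    intro c hc
    have h1 : ContMDiffAt 𝓘(ℝ, E) 𝓘(ℝ, F) ∞ c (ρ.act x 1) :=
      ρ.smooth_coefficients (ρ.orbitDeriv_injective hρ _) (hc _)
    have h2 : ContMDiffAt 𝓘(ℝ, F) 𝓘(ℝ, F) ∞ (fun g : S => c (ρ.act x g)) 1 :=
      h1.comp (1 : S) (ρ.smooth_orbit x 1)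
    exact ((translation (F := F) S).smooth_combination h2).mdifferentiableAt (by simp)
  have : IsManifold 𝓘(ℝ, F) ∞ S := inferInstance
  have key := mfderiv_mlieBracket_of_related (ρ.smooth_orbit x) (1 : S) (lift a ha) (lift b hb)
    ((ha _).mdifferentiableAt (by simp)) ((hb _).mdifferentiableAt (by simp))
    (fun g => ρ.mfderiv_orbit_mulInvariant x g (a (ρ.act x g)))
    (fun g => ρ.mfderiv_orbit_mulInvariant x g (b (ρ.act x g)))
  have htransport : ∀ y : M, y = x →
      (mlieBracket 𝓘(ℝ, E) (fun x => ρ.orbitDeriv x (a x)) (fun x => ρ.orbitDeriv x (b x)) y : E) =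
      mlieBracket 𝓘(ℝ, E) (fun x => ρ.orbitDeriv x (a x)) (fun x => ρ.orbitDeriv x (b x)) x := by
    rintro y rfl
    rfl
  exact ⟨_, Eq.trans key (htransport _ (ρ.act_one x))⟩

end Smoothness

end SmoothRightAction

end Preliminaries

/-! ### The Chevalley–Eilenberg formula -/

section Koszul

/-- The alternating sum
`∑ i, (-1)^i X_i · φ(X_0, …, X̂_i, …, X_p)
  + ∑ i < j, (-1)^(i+j) φ([X_i, X_j], X_0, …, X̂_i, …, X̂_j, …, X_p)`.
In each term of the second sum the bracket is moved from the front to the place of the omitted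
`X_i`, which turns the sign into `(-1)^j`. The bracket and the operators `X · w` are arguments. -/
def koszul {L W : Type*} [AddCommGroup W] (bracket : L → L → L) (act : L → W → W) {p : ℕ}
    (φ : (Fin p → L) → W) (X : Fin (p + 1) → L) : W :=
  ∑ i : Fin (p + 1), (-1 : ℤ) ^ (i : ℕ) • act (X i) (φ fun k => X (i.succAbove k)) +
    ∑ i : Fin (p + 1), ∑ j ∈ Finset.Ioi i, (-1 : ℤ) ^ (j : ℕ) •
      φ fun k => Function.update X i (bracket (X i) (X j)) (j.succAbove k)

theorem koszul_add {L W : Type*} [AddCommGroup W] (bracket : L → L → L) (act : L → W → W) {p : ℕ}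
    (φ ψ : (Fin p → L) → W) (X : Fin (p + 1) → L)
    (h : ∀ i : Fin (p + 1), act (X i) ((φ fun k => X (i.succAbove k)) + ψ fun k => X (i.succAbove k))
      = act (X i) (φ fun k => X (i.succAbove k)) + act (X i) (ψ fun k => X (i.succAbove k))) :
    koszul bracket act (fun Y => φ Y + ψ Y) X = koszul bracket act φ X + koszul bracket act ψ X := by
  simp only [koszul, h, smul_add, Finset.sum_add_distrib]
  abel

theorem koszul_smul {L W : Type*} [AddCommGroup W] [Module ℝ W] (bracket : L → L → L)
    (act : L → W → W) {p : ℕ} (c : ℝ) (φ : (Fin p → L) → W) (X : Fin (p + 1) → L)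
    (h : ∀ i : Fin (p + 1), act (X i) (c • φ fun k => X (i.succAbove k))
      = c • act (X i) (φ fun k => X (i.succAbove k))) :
    koszul bracket act (fun Y => c • φ Y) X = c • koszul bracket act φ X := by
  simp only [koszul, h, smul_add, Finset.smul_sum, smul_comm c]

end Koszul

/-! ### Lie algebra cohomology with coefficients -/

section LieAlgebraCohomology

variable {L : Type*} [LieRing L] [LieAlgebra ℝ L] {V : Type*} [AddCommGroup V] [Module ℝ V]

attribute [local instance] LieRing.ofAssociativeRing in
/-- A representation of the Lie algebra `L` on `V`: a homomorphism of Lie algebras `L → End(V)`,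
where `End(V)` carries the commutator bracket. -/
abbrev LieRep (L V : Type*) [LieRing L] [LieAlgebra ℝ L] [AddCommGroup V] [Module ℝ V] : Type _ :=
  L →ₗ⁅ℝ⁆ Module.End ℝ V

/-- The space `Hom(⋀^p L, V)` of `p`-cochains. -/
abbrev LieCochain (L V : Type*) [LieRing L] [LieAlgebra ℝ L] [AddCommGroup V] [Module ℝ V]
    (p : ℕ) : Type _ := L [⋀^Fin p]→ₗ[ℝ] V

/-- The differential of the complex `Hom(⋀^* L, V)` of the representation `π`; the value at `φ` is
given as a function of `p + 1` elements of `L`. -/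
def lieDifferential (π : LieRep L V) (p : ℕ) :
    LieCochain L V p →ₗ[ℝ] ((Fin (p + 1) → L) → V) where
  toFun φ := koszul (fun X Y => ⁅X, Y⁆) (fun X v => π X v) φ
  map_add' φ ψ := by
    funext X
    exact koszul_add _ _ φ ψ X fun i => map_add _ _ _
  map_smul' c φ := by
    funext X
    exact koszul_smul _ _ c φ X fun i => map_smul _ _ _

/-- A cochain as a function. -/
def lieEval (L V : Type*) [LieRing L] [LieAlgebra ℝ L] [AddCommGroup V] [Module ℝ V] (p : ℕ) :
    LieCochain L V p →ₗ[ℝ] ((Fin p → L) → V) where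
  toFun φ := φ
  map_add' _ _ := rfl
  map_smul' _ _ := rfl

/-- The `p`-cocycles of `L` with coefficients in `π`. -/
def lieCocycles (π : LieRep L V) (p : ℕ) : Submodule ℝ (LieCochain L V p) :=
  LinearMap.ker (lieDifferential π p)

/-- The `p`-coboundaries of `L` with coefficients in `π`: the `p`-cochains that are differentials
of `(p - 1)`-cochains. -/
def lieCoboundaries (π : LieRep L V) : (p : ℕ) → Submodule ℝ (LieCochain L V p)
  | 0 => ⊥
  | p + 1 => (LinearMap.range (lieDifferential π p)).comap (lieEval L V (p + 1))

/-- The cohomology `H^p(L; π)`. -/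
abbrev LieCohomology (π : LieRep L V) (p : ℕ) : Type _ :=
  lieCocycles π p ⧸ (lieCoboundaries π p).submoduleOf (lieCocycles π p)

end LieAlgebraCohomology

/-! ### Leafwise cohomology -/

section Leafwise

variable {E : Type*} [NormedAddCommGroup E] [NormedSpace ℝ E] [FiniteDimensional ℝ E]
  {F : Type*} [NormedAddCommGroup F] [NormedSpace ℝ F] [FiniteDimensional ℝ F]
  {M : Type*} [TopologicalSpace M] [ChartedSpace E M] [IsManifold 𝓘(ℝ, E) ∞ M]
  {S : Type*} [TopologicalSpace S] [ChartedSpace F S] [Group S] [LieGroup 𝓘(ℝ, F) ∞ S]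
  {V : Type*} [NormedAddCommGroup V] [NormedSpace ℝ V]

/-- A `C^∞` Lie group has the smoothness that Mathlib asks for its Lie algebra. -/
instance lieGroup_minSmoothness : LieGroup 𝓘(ℝ, F) (minSmoothness ℝ 3) S :=
  LieGroup.of_le (n := ∞) (by
    rw [minSmoothness_of_isRCLikeNormedField]
    exact ENat.LEInfty.out)

/-- A locally free `C^∞` right action of the Lie group `S` on the manifold `M`. -/
structure LocallyFreeAction (E F M S : Type*) [NormedAddCommGroup E] [NormedSpace ℝ E]
    [NormedAddCommGroup F] [NormedSpace ℝ F] [TopologicalSpace M] [ChartedSpace E M]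
    [TopologicalSpace S] [ChartedSpace F S] [Group S] extends SmoothRightAction E F M S where
  locallyFree : toSmoothRightAction.LocallyFree

/-- A multilinear map applied to smooth functions is smooth. -/
theorem contMDiff_multilinear {p : ℕ} (f : MultilinearMap ℝ (fun _ : Fin p => F) V)
    {a : Fin p → M → F} (ha : ∀ k, ContMDiff 𝓘(ℝ, E) 𝓘(ℝ, F) ∞ (a k)) :
    ContMDiff 𝓘(ℝ, E) 𝓘(ℝ, V) ∞ (fun x => f fun k => a k x) := by
  let b := Module.finBasis ℝ F
  have hexp : (fun x => f fun k => a k x) = fun x => ∑ r : Fin p → Fin (Module.finrank ℝ F),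
      (∏ k, b.repr (a k x) (r k)) • f fun k => b (r k) := by
    funext x
    have h1 : (fun k => a k x) = fun k => ∑ j, b.repr (a k x) j • b j :=
      funext fun k => (b.sum_repr (a k x)).symm
    rw [h1, f.map_sum]
    refine Finset.sum_congr rfl fun r _ => ?_
    rw [f.map_smul_univ]
  rw [hexp]
  refine ContMDiff.sum fun r _ => ?_
  have hprod : ContMDiff 𝓘(ℝ, E) 𝓘(ℝ, ℝ) ∞ (fun x => ∏ k, b.repr (a k x) (r k)) :=
    ContMDiff.prod fun k _ =>
      (LinearMap.toContinuousLinearMap (b.coord (r k))).contMDiff.comp (ha k)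
  exact hprod.smul contMDiff_const

namespace LocallyFreeAction

variable (ρ : LocallyFreeAction E F M S)

/-- The tangent space `T_x 𝓕` at `x` of the orbit foliation. -/
noncomputable def leafTangent (x : M) : Submodule ℝ (TangentSpace 𝓘(ℝ, E) x) :=
  LinearMap.range (ρ.orbitDeriv x).toLinearMap

/-- The canonical `1`-form `(ω₀)_x : T_x 𝓕 → 𝔰`, the inverse of the derivative at the identity of
the orbit map of `x`. -/
noncomputable def canonicalForm (x : M) : ρ.leafTangent x ≃ₗ[ℝ] GroupLieAlgebra 𝓘(ℝ, F) S :=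
  (LinearEquiv.ofInjective (ρ.orbitDeriv x).toLinearMap
    (ρ.orbitDeriv_injective ρ.locallyFree x)).symm

theorem orbitDeriv_canonicalForm (x : M) (v : ρ.leafTangent x) :
    ρ.orbitDeriv x (ρ.canonicalForm x v) = v :=
  LinearEquiv.ofInjective_symm_apply (f := (ρ.orbitDeriv x).toLinearMap) (h := ρ.orbitDeriv_injective ρ.locallyFree x) v

/-- The `C^∞` vector fields on `M` tangent to the orbit foliation. -/
structure LeafwiseField where
  toFun : ∀ x, ρ.leafTangent x
  smooth : ContMDiff 𝓘(ℝ, E) (𝓘(ℝ, E).prod 𝓘(ℝ, E)) ∞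
    (fun x => (⟨x, (toFun x : TangentSpace 𝓘(ℝ, E) x)⟩ : TangentBundle 𝓘(ℝ, E) M))

variable {ρ} in
/-- The `𝔰`-valued function `ω₀(X)` is smooth. -/
theorem smooth_canonicalForm (X : ρ.LeafwiseField) :
    ContMDiff 𝓘(ℝ, E) 𝓘(ℝ, F) ∞ (M' := F)
      (fun x => ρ.canonicalForm x (X.toFun x)) := by
  intro x
  refine ρ.smooth_coefficients (ρ.orbitDeriv_injective ρ.locallyFree x) ?_
  refine (X.smooth x).congr_of_eventuallyEq (Filter.Eventually.of_forall fun y => ?_)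
  exact congrArg (fun w => (⟨y, w⟩ : TangentBundle 𝓘(ℝ, E) M))
    (ρ.orbitDeriv_canonicalForm y (X.toFun y))

theorem isManifold_minSmoothness : IsManifold 𝓘(ℝ, E) (minSmoothness ℝ 3) M :=
  IsManifold.of_le (n := ∞) (by
    rw [minSmoothness_of_isRCLikeNormedField]
    exact ENat.LEInfty.out)

/-- The Lie bracket of vector fields, for vector fields tangent to the orbit foliation. -/
noncomputable def fieldBracket (X Y : ρ.LeafwiseField) : ρ.LeafwiseField where
  toFun x := ⟨VectorField.mlieBracket 𝓘(ℝ, E) (fun y => (X.toFun y : TangentSpace 𝓘(ℝ, E) y))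
      (fun y => (Y.toFun y : TangentSpace 𝓘(ℝ, E) y)) x, by
    have hX : (fun y => (X.toFun y : TangentSpace 𝓘(ℝ, E) y)) =
        fun y => ρ.orbitDeriv y (ρ.canonicalForm y (X.toFun y)) :=
      funext fun y => (ρ.orbitDeriv_canonicalForm y (X.toFun y)).symm
    have hY : (fun y => (Y.toFun y : TangentSpace 𝓘(ℝ, E) y)) =
        fun y => ρ.orbitDeriv y (ρ.canonicalForm y (Y.toFun y)) :=
      funext fun y => (ρ.orbitDeriv_canonicalForm y (Y.toFun y)).symm
    have hXs := X.smooth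
    have hYs := Y.smooth
    change ContMDiff _ _ _ (fun x => (⟨x, (fun y => (X.toFun y : TangentSpace 𝓘(ℝ, E) y)) x⟩ :
      TangentBundle 𝓘(ℝ, E) M)) at hXs
    change ContMDiff _ _ _ (fun x => (⟨x, (fun y => (Y.toFun y : TangentSpace 𝓘(ℝ, E) y)) x⟩ :
      TangentBundle 𝓘(ℝ, E) M)) at hYs
    rw [hX] at hXs ⊢
    rw [hY] at hYs ⊢
    exact ρ.mlieBracket_mem_range ρ.locallyFree _ _ hXs hYs x⟩
  smooth x := by
    have : IsManifold 𝓘(ℝ, E) (minSmoothness ℝ 3) M := isManifold_minSmoothness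
    have : IsManifold 𝓘(ℝ, E) (((⊤ : ℕ∞) : WithTop ℕ∞) + 1) M := by
      have h : ((⊤ : ℕ∞) : WithTop ℕ∞) + 1 = ∞ := by simp
      rw [h]
      infer_instance
    exact (X.smooth x).mlieBracket_vectorField (m := (⊤ : ℕ∞)) (n := (⊤ : ℕ∞)) (Y.smooth x)
      (by simp)

/-- The families `η` of alternating `p`-linear maps `η_x : (T_x 𝓕)^p → V` that are smooth in the
sense that `η(X_1, …, X_p)` is a smooth function for all smooth vector fields `X_i` tangent to the
foliation. -/
noncomputable def leafwiseFormSubmodule (V : Type*) [NormedAddCommGroup V] [NormedSpace ℝ V]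
    (p : ℕ) : Submodule ℝ (∀ x, ρ.leafTangent x [⋀^Fin p]→ₗ[ℝ] V) where
  carrier := {η | ∀ X : Fin p → ρ.LeafwiseField,
    ContMDiff 𝓘(ℝ, E) 𝓘(ℝ, V) ∞ (fun x => η x fun k => (X k).toFun x)}
  add_mem' h₁ h₂ X := (h₁ X).add (h₂ X)
  zero_mem' _ := contMDiff_const
  smul_mem' c _ h X :=
    (contMDiff_const (I := 𝓘(ℝ, E)) (I' := 𝓘(ℝ, ℝ)) (n := ∞) (c := c)).smul (h X)

/-- The space `Ω^p(𝓕; V)` of leafwise `V`-valued `p`-forms. -/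
def LeafwiseForm (V : Type*) [NormedAddCommGroup V] [NormedSpace ℝ V] (p : ℕ) : Type _ :=
  ↥(ρ.leafwiseFormSubmodule V p)

noncomputable instance leafwiseFormAddCommGroup (V : Type*) [NormedAddCommGroup V] [NormedSpace ℝ V] (p : ℕ) :
    AddCommGroup (ρ.LeafwiseForm V p) :=
  Submodule.addCommGroup (ρ.leafwiseFormSubmodule V p)

noncomputable instance leafwiseFormModule (V : Type*) [NormedAddCommGroup V] [NormedSpace ℝ V] (p : ℕ) :
    Module ℝ (ρ.LeafwiseForm V p) :=
  Submodule.module (ρ.leafwiseFormSubmodule V p)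

/-- The value `η(X_1, …, X_p) : M → V` of a form on vector fields. -/
noncomputable def formEval (V : Type*) [NormedAddCommGroup V] [NormedSpace ℝ V] (p : ℕ) :
    ρ.LeafwiseForm V p →ₗ[ℝ] ((Fin p → ρ.LeafwiseField) → M → V) where
  toFun η X x := η.1 x fun k => (X k).toFun x
  map_add' _ _ := rfl
  map_smul' _ _ := rfl

variable {ρ} in
/-- The derivative `X ξ` of a function `ξ : M → V` along the vector field `X`. -/
noncomputable def fieldDeriv (X : ρ.LeafwiseField) (ξ : M → V) (x : M) : V :=
  mfderiv 𝓘(ℝ, E) 𝓘(ℝ, V) ξ x (X.toFun x : TangentSpace 𝓘(ℝ, E) x)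

variable {ρ} in
/-- The covariant derivative `∇_X ξ = X ξ + π(ω₀(X)) ξ` of a section `ξ : M → V` of the trivial
bundle. -/
noncomputable def covariantDeriv (π : LieRep (GroupLieAlgebra 𝓘(ℝ, F) S) V)
    (X : ρ.LeafwiseField) (ξ : M → V) (x : M) : V :=
  fieldDeriv X ξ x + π (ρ.canonicalForm x (X.toFun x)) (ξ x)

theorem covariantDeriv_add (π : LieRep (GroupLieAlgebra 𝓘(ℝ, F) S) V)
    (X : ρ.LeafwiseField) {ξ ζ : M → V} (hξ : ContMDiff 𝓘(ℝ, E) 𝓘(ℝ, V) ∞ ξ)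
    (hζ : ContMDiff 𝓘(ℝ, E) 𝓘(ℝ, V) ∞ ζ) :
    covariantDeriv π X (ξ + ζ) = covariantDeriv π X ξ + covariantDeriv π X ζ := by
  funext x
  have h1 := mfderiv_add (hξ.mdifferentiable (by simp) x) (hζ.mdifferentiable (by simp) x)
  have h2 := congrArg (fun T : E →L[ℝ] V => T (X.toFun x : TangentSpace 𝓘(ℝ, E) x)) h1
  have h3 : fieldDeriv X (ξ + ζ) x = fieldDeriv X ξ x + fieldDeriv X ζ x := h2
  have h4 := map_add (π (ρ.canonicalForm x (X.toFun x))) (ξ x) (ζ x)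
  exact (congrArg₂ (fun v w : V => v + w) h3 h4).trans (add_add_add_comm _ _ _ _)

theorem covariantDeriv_smul (π : LieRep (GroupLieAlgebra 𝓘(ℝ, F) S) V)
    (X : ρ.LeafwiseField) (c : ℝ) {ξ : M → V} (hξ : ContMDiff 𝓘(ℝ, E) 𝓘(ℝ, V) ∞ ξ) :
    covariantDeriv π X (c • ξ) = c • covariantDeriv π X ξ := by
  funext x
  have h1 := const_smul_mfderiv (hξ.mdifferentiable (by simp) x) c
  have h2 := congrArg (fun T : E →L[ℝ] V => T (X.toFun x : TangentSpace 𝓘(ℝ, E) x)) h1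
  have h3 : fieldDeriv X (c • ξ) x = c • fieldDeriv X ξ x := h2
  have h4 := map_smul (π (ρ.canonicalForm x (X.toFun x))) c (ξ x)
  exact (congrArg₂ (fun v w : V => v + w) h3 h4).trans (smul_add _ _ _).symm

/-- The covariant exterior derivative `D` on `Ω^p(𝓕; V)` of the flat leafwise connection with
connection form `π ω₀`; the value at `η` is given as a function of `p + 1` vector fields tangent to
the foliation. -/
noncomputable def covariantDifferential (π : LieRep (GroupLieAlgebra 𝓘(ℝ, F) S) V)
    (p : ℕ) : ρ.LeafwiseForm V p →ₗ[ℝ] ((Fin (p + 1) → ρ.LeafwiseField) → M → V) where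
  toFun η := koszul ρ.fieldBracket (covariantDeriv π) (ρ.formEval V p η)
  map_add' η θ := by
    funext X
    exact koszul_add _ _ (ρ.formEval V p η) (ρ.formEval V p θ) X
      fun i => ρ.covariantDeriv_add π (X i) (η.2 _) (θ.2 _)
  map_smul' c η := by
    funext X
    exact koszul_smul _ _ c (ρ.formEval V p η) X fun i => ρ.covariantDeriv_smul π (X i) c (η.2 _)

/-- The closed forms: `D η = 0`. -/
noncomputable def cocycles (π : LieRep (GroupLieAlgebra 𝓘(ℝ, F) S) V) (p : ℕ) :
    Submodule ℝ (ρ.LeafwiseForm V p) :=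
  LinearMap.ker (ρ.covariantDifferential π p)

/-- The exact forms: the `p`-forms `D ζ` with a `(p - 1)`-form `ζ`. -/
noncomputable def coboundaries (π : LieRep (GroupLieAlgebra 𝓘(ℝ, F) S) V) :
    (p : ℕ) → Submodule ℝ (ρ.LeafwiseForm V p)
  | 0 => ⊥
  | p + 1 => (LinearMap.range (ρ.covariantDifferential π p)).comap (ρ.formEval V (p + 1))

/-- The leafwise cohomology `H^p(𝓕; π)`. -/
abbrev Cohomology (π : LieRep (GroupLieAlgebra 𝓘(ℝ, F) S) V) (p : ℕ) : Type _ :=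
  ρ.cocycles π p ⧸ (ρ.coboundaries π p).submoduleOf (ρ.cocycles π p)

/-- The pullback `φ ↦ ω₀^* φ` by the canonical `1`-form. -/
noncomputable def pullback (V : Type*) [NormedAddCommGroup V] [NormedSpace ℝ V] (p : ℕ) :
    LieCochain (GroupLieAlgebra 𝓘(ℝ, F) S) V p →ₗ[ℝ] ρ.LeafwiseForm V p where
  toFun φ := ⟨fun x => φ.compLinearMap (ρ.canonicalForm x).toLinearMap, fun X =>
    contMDiff_multilinear (F := F) (φ.toMultilinearMap) fun k => smooth_canonicalForm (X k)⟩
  map_add' _ _ := rfl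
  map_smul' _ _ := rfl

end LocallyFreeAction

end Leafwise

end LeafwiseCohomology

/-! The pullback `ω₀^*` has a left inverse given by averaging. Since `S` is solvable, it is
amenable, so its action on the compact space `M` admits an invariant mean `m` on the continuous
functions. In the frame of fundamental vector fields a leafwise form is a family of cochains on `𝔰`
with coefficients in `C(M, V)`, and `m` turns it into a single cochain `A η`.

Three facts give injectivity. First, `D (ω₀^* φ) = ω₀^* (d φ)`, by the structure equation for `ω₀`
(`covariantDifferential_pullback`); this also makes the map on cohomology well defined. Second, `A
(ω₀^* φ) = φ`, because `ω₀^* φ` has constant coefficients (`averageCochain_pullback`). Third, `A (D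
ζ) = d (A ζ)` (`vectorMean_covariantDifferential`): on fundamental fields, `D` differs from the
Chevalley–Eilenberg formula only by derivatives along these fields, and an invariant mean kills such
derivatives (`InvariantMean.apply_eq_zero_of_eq_deriv`). Hence `ω₀^* φ = D ζ` forces `φ = d (A ζ)`.

The mean comes from an invariant Hahn–Banach theorem, proved by climbing the derived series with a
Markov–Kakutani argument at each stage. No measure theory is needed. -/

namespace LeafwiseCohomology

/-! ### Invariant Hahn–Banach theorem for solvable groups -/

section InvariantHahnBanach

variable {G W : Type*} [Group G] [AddCommGroup W] [Module ℝ W]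

/-- Subadditive and positively homogeneous functions on a real vector space. -/
structure IsSublinear (p : W → ℝ) : Prop where
  smul : ∀ c : ℝ, 0 < c → ∀ x, p (c • x) = c * p x
  add : ∀ x y, p (x + y) ≤ p x + p y

namespace IsSublinear

variable {p : W → ℝ}

theorem map_zero (hp : IsSublinear p) : p 0 = 0 := by
  have := hp.smul 2 (by norm_num) 0
  rw [smul_zero] at this
  linarith

theorem smul_of_nonneg (hp : IsSublinear p) {c : ℝ} (hc : 0 ≤ c) (x : W) :
    p (c • x) = c * p x := by
  rcases hc.eq_or_lt with rfl | hc
  · simp [hp.map_zero]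
  · exact hp.smul c hc x

theorem neg_le (hp : IsSublinear p) (x : W) : -p (-x) ≤ p x := by
  have := hp.add x (-x)
  rw [add_neg_cancel, hp.map_zero] at this
  linarith

/-- Hahn–Banach, extending the zero form from the zero subspace. -/
theorem exists_linear_le (hp : IsSublinear p) : ∃ m : W →ₗ[ℝ] ℝ, ∀ x, m x ≤ p x := by
  obtain ⟨m, -, hm⟩ := exists_extension_of_le_sublinear (⟨⊥, 0⟩ : W →ₗ.[ℝ] ℝ) p hp.smul hp.add
    (by
      rintro ⟨x, hx⟩
      obtain rfl : x = 0 := by simpa using hx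
      simp [hp.map_zero])
  exact ⟨m, hm⟩

/-- Used with `U` a space of endomorphisms, so that an estimate checked on a set of operators passes
to its convex hull. -/
theorem convex_setOf_le (hp : IsSublinear p) {U : Type*} [AddCommGroup U] [Module ℝ U]
    (T : U →ₗ[ℝ] W) (c : ℝ) : Convex ℝ {A : U | p (T A) ≤ c} := by
  intro A hA B hB a b ha hb hab
  simp only [Set.mem_ofPred_eq] at *
  rw [map_add, map_smul, map_smul]
  calc _ ≤ p (a • T A) + p (b • T B) := hp.add _ _
    _ = a * p (T A) + b * p (T B) := by rw [hp.smul_of_nonneg ha, hp.smul_of_nonneg hb]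
    _ ≤ a * c + b * c := by gcongr
    _ = c := by rw [← add_mul, hab, one_mul]

end IsSublinear

/-- If the subgroup `H` preserves the sublinear function `p` and `p` does not see the commutators
of `H`, then `p` dominates a linear form that is invariant under `H`. -/
theorem exists_invariant_le_of_commute {τ : Representation ℝ G W} {H : Subgroup G} {p : W → ℝ}
    (hp : IsSublinear p) (hinv : ∀ h ∈ H, ∀ x, p (τ h x) ≤ p x)
    (hcomm : ∀ g ∈ H, ∀ h ∈ H, ∀ x, p (τ (g * h) x - τ (h * g) x) ≤ 0) :
    ∃ m : W →ₗ[ℝ] ℝ, (∀ x, m x ≤ p x) ∧ ∀ h ∈ H, ∀ x, m (τ h x) = m x := by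
  set C : Set (Module.End ℝ W) := convexHull ℝ (τ '' (H : Set G)) with hC
  have hle : ∀ A ∈ C, ∀ x, p (A x) ≤ p x := by
    intro A hA x
    refine convexHull_min ?_ (hp.convex_setOf_le (LinearMap.applyₗ x) (p x)) hA
    rintro _ ⟨h, hh, rfl⟩
    exact hinv h hh x
  -- The commutator is linear in each factor separately, so the estimate passes to the convex hull
  -- one factor at a time.
  have hcomm' : ∀ A ∈ C, ∀ B ∈ C, ∀ x, p (A (B x) - B (A x)) ≤ 0 := by
    intro A hA B hB x
    refine convexHull_min ?_ (hp.convex_setOf_le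
      (LinearMap.applyₗ (B x) - B ∘ₗ LinearMap.applyₗ x) 0) hA
    rintro _ ⟨g, hg, rfl⟩
    refine convexHull_min ?_ (hp.convex_setOf_le
      ((τ g) ∘ₗ LinearMap.applyₗ x - LinearMap.applyₗ (τ g x)) 0) hB
    rintro _ ⟨h, hh, rfl⟩
    simpa using hcomm g hg h hh x
  have hmul : ∀ A ∈ C, ∀ B ∈ C, A * B ∈ C := by
    intro A hA B hB
    refine convexHull_min ?_ ((convex_convexHull ℝ _).linear_preimage
      (LinearMap.mulRight ℝ B)) hA
    rintro _ ⟨g, hg, rfl⟩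
    refine convexHull_min ?_ ((convex_convexHull ℝ _).linear_preimage
      (LinearMap.mulLeft ℝ (τ g))) hB
    rintro _ ⟨h, hh, rfl⟩
    exact subset_convexHull _ _ ⟨g * h, H.mul_mem hg hh, map_mul τ g h⟩
  have hone : (1 : Module.End ℝ W) ∈ C := subset_convexHull _ _ ⟨1, H.one_mem, map_one τ⟩
  have : Nonempty C := ⟨⟨1, hone⟩⟩
  -- The lower bound is `p (A x) ≥ -p (-A x) ≥ -p (-x)`.
  have hbdd : ∀ x, BddBelow (Set.range fun A : C => p (A.1 x)) := by
    intro x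
    refine ⟨-p (-x), ?_⟩
    rintro _ ⟨A, rfl⟩
    have h1 := hp.neg_le (A.1 x)
    have h2 := hle A.1 A.2 (-x)
    rw [map_neg] at h2
    simp only
    linarith
  -- Every linear form below `q` turns out to be invariant, so plain Hahn–Banach applied to `q`
  -- suffices.
  set q : W → ℝ := fun x => ⨅ A : C, p (A.1 x) with hq
  have hqle : ∀ A ∈ C, ∀ x, q x ≤ p (A x) := fun A hA x => ciInf_le (hbdd x) ⟨A, hA⟩
  have hqs : IsSublinear q := by
    refine ⟨fun c hc x => ?_, fun x y => ?_⟩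
    · simp only [hq, map_smul, hp.smul c hc]
      exact (Real.mul_iInf_of_nonneg hc.le _).symm
    -- Given competitors `A` for `x` and `B` for `y`, the product `A * B` serves for `x + y`. On `y`
    -- the factor `A` does not increase `p`; on `x` the factors are first swapped, at no cost by
    -- `hcomm'`.
    · refine le_ciInf_add_ciInf fun A B => ?_
      refine (hqle _ (hmul A.1 A.2 B.1 B.2) (x + y)).trans ?_
      rw [map_add]
      refine (hp.add _ _).trans (add_le_add ?_ (hle A.1 A.2 _))
      have h1 := hp.add (B.1 (A.1 x)) (A.1 (B.1 x) - B.1 (A.1 x))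
      rw [add_sub_cancel] at h1
      have h2 := hcomm' A.1 A.2 B.1 B.2 x
      have h3 := hle B.1 B.2 (A.1 x)
      simp only [Module.End.mul_apply]
      linarith
  have hqH : ∀ h ∈ H, ∀ x, q (x - τ h x) ≤ 0 := by
    intro h hh x
    have key : ∀ n : ℕ, q (x - τ h x) ≤ (1 / ((n : ℝ) + 1)) * (p x + p (-x)) := by
      intro n
      -- Cesàro averages of the powers of `h` telescope on `x - τ h x`, leaving a term of order `1 /
      -- (n + 1)`.
      have hmem : (∑ k ∈ Finset.range (n + 1), (1 / ((n : ℝ) + 1)) • τ (h ^ k)) ∈ C := by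
        refine (convex_convexHull ℝ _).sum_mem (fun _ _ => by positivity) ?_
          fun k _ => subset_convexHull _ _ ⟨h ^ k, H.pow_mem hh k, rfl⟩
        simp only [Finset.sum_const, Finset.card_range, nsmul_eq_mul]
        push_cast
        field_simp
      refine (hqle _ hmem _).trans ?_
      have : (∑ k ∈ Finset.range (n + 1), (1 / ((n : ℝ) + 1)) • τ (h ^ k)) (x - τ h x) =
          (1 / ((n : ℝ) + 1)) • (x + -τ (h ^ (n + 1)) x) := by
        rw [← Finset.smul_sum, LinearMap.smul_apply, LinearMap.sum_apply]
        congr 1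
        have h1 : ∀ k, τ (h ^ k) (x - τ h x) = τ (h ^ k) x - τ (h ^ (k + 1)) x := by
          intro k
          rw [map_sub, pow_succ, map_mul, Module.End.mul_apply]
        simp only [h1]
        rw [Finset.sum_range_sub']
        simp [sub_eq_add_neg]
      rw [this, hp.smul _ (by positivity)]
      have h2 := hinv _ (H.pow_mem hh (n + 1)) (-x)
      rw [map_neg] at h2
      have h3 := hp.add x (-τ (h ^ (n + 1)) x)
      gcongr
      linarith
    have hlim : Filter.Tendsto (fun n : ℕ => (1 / ((n : ℝ) + 1)) * (p x + p (-x))) Filter.atTop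
        (nhds (0 * (p x + p (-x)))) := tendsto_one_div_add_atTop_nhds_zero_nat.mul_const _
    rw [zero_mul] at hlim
    exact ge_of_tendsto' hlim key
  obtain ⟨m, hm⟩ := hqs.exists_linear_le
  refine ⟨m, fun x => (hm x).trans (hqle 1 hone x), fun h hh x => ?_⟩
  -- The inequality for `x` and for `-x` together give equality.
  have h1 := (hm _).trans (hqH h hh x)
  have h2 := (hm _).trans (hqH h hh (-x))
  simp only [map_sub, map_neg] at h1 h2
  linarith

open scoped commutatorElement in
/-- The invariant Hahn–Banach theorem for solvable groups. -/
theorem exists_invariant_le_of_isSolvable [Group.IsSolvable G] (τ : Representation ℝ G W)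
    {p : W → ℝ} (hp : IsSublinear p) (hinv : ∀ g x, p (τ g x) ≤ p x) :
    ∃ m : W →ₗ[ℝ] ℝ, (∀ x, m x ≤ p x) ∧ ∀ g x, m (τ g x) = m x := by
  -- Invariance is improved from one term of the derived series to the preceding, larger one. The
  -- sublinear function for this is the supremum `q` of all dominated forms invariant under the
  -- smaller term; it is again bounded by `p`.
  have step : ∀ k, (∃ m : W →ₗ[ℝ] ℝ, (∀ x, m x ≤ p x) ∧
      ∀ g ∈ derivedSeries G (k + 1), ∀ x, m (τ g x) = m x) → ∃ m : W →ₗ[ℝ] ℝ, (∀ x, m x ≤ p x) ∧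
      ∀ g ∈ derivedSeries G k, ∀ x, m (τ g x) = m x := by
    rintro k ⟨m₀, hm₀⟩
    let K : Set (W →ₗ[ℝ] ℝ) := {m | (∀ x, m x ≤ p x) ∧
      ∀ g ∈ derivedSeries G (k + 1), ∀ x, m (τ g x) = m x}
    have : Nonempty K := ⟨⟨m₀, hm₀⟩⟩
    have hbdd : ∀ x, BddAbove (Set.range fun m : K => m.1 x) := by
      intro x
      refine ⟨p x, ?_⟩
      rintro _ ⟨m, rfl⟩
      exact m.2.1 x
    let q : W → ℝ := fun x => ⨆ m : K, m.1 x
    have hqs : IsSublinear q := by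
      refine ⟨fun c hc x => ?_, fun x y => ?_⟩
      · simp only [q, map_smul, smul_eq_mul]
        exact (Real.mul_iSup_of_nonneg hc.le _).symm
      · refine ciSup_le fun m => ?_
        rw [map_add]
        exact add_le_add (le_ciSup (hbdd x) m) (le_ciSup (hbdd y) m)
    -- Normality of the smaller term makes `K` stable under translation, so `q` does not increase.
    -- Forms in `K` ignore commutators, as `g * h = ⁅g, h⁆ * (h * g)`, so `q` does not see the
    -- difference of the two products.
    obtain ⟨m, hm, hmi⟩ := exists_invariant_le_of_commute (τ := τ) (H := derivedSeries G k) hqs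
      (fun h _ x => by
        refine ciSup_le fun m => ?_
        refine le_ciSup (hbdd x) (⟨m.1 ∘ₗ τ h, fun y => (m.2.1 _).trans (hinv h y),
          fun g hg y => ?_⟩ : K)
        have h1 := m.2.2 (h * g * h⁻¹) ((derivedSeries_normal G (k + 1)).conj_mem g hg h) (τ h y)
        rw [← Module.End.mul_apply, ← map_mul, inv_mul_cancel_right, map_mul] at h1
        exact h1)
      (fun g hg h hh x => by
        refine ciSup_le fun m => ?_
        have h1 := m.2.2 ⁅g, h⁆ (Subgroup.commutator_mem_commutator hg hh) (τ (h * g) x)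
        rw [← Module.End.mul_apply, ← map_mul] at h1
        have h2 : ⁅g, h⁆ * (h * g) = g * h := by
          rw [commutatorElement_def]
          group
        rw [h2] at h1
        rw [map_sub, h1, sub_self])
    exact ⟨m, fun x => (hm x).trans (ciSup_le fun m => m.2.1 x), hmi⟩
  obtain ⟨n, hn⟩ := Group.IsSolvable.solvable (G := G)
  have top : ∃ m : W →ₗ[ℝ] ℝ, (∀ x, m x ≤ p x) ∧
      ∀ g ∈ derivedSeries G n, ∀ x, m (τ g x) = m x := by
    obtain ⟨m, hm⟩ := hp.exists_linear_le
    refine ⟨m, hm, fun g hg x => ?_⟩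
    rw [hn, Subgroup.mem_bot] at hg
    rw [hg, map_one, Module.End.one_apply]
  have descend : ∀ k, (∃ m : W →ₗ[ℝ] ℝ, (∀ x, m x ≤ p x) ∧
      ∀ g ∈ derivedSeries G k, ∀ x, m (τ g x) = m x) → ∃ m : W →ₗ[ℝ] ℝ, (∀ x, m x ≤ p x) ∧
      ∀ g ∈ derivedSeries G 0, ∀ x, m (τ g x) = m x := by
    intro k
    induction k with
    | zero => exact id
    | succ k ih => exact fun h => ih (step k h)
  obtain ⟨m, hm, hmi⟩ := descend n top
  exact ⟨m, hm, fun g => hmi g (by simp)⟩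

end InvariantHahnBanach

/-! ### Invariant means and derivatives along the action -/

section InvariantMean

variable {E : Type*} [NormedAddCommGroup E] [NormedSpace ℝ E]
  {F : Type*} [NormedAddCommGroup F] [NormedSpace ℝ F]
  {M : Type*} [TopologicalSpace M] [ChartedSpace E M]
  {S : Type*} [TopologicalSpace S] [ChartedSpace F S] [Group S]
  {V : Type*} [NormedAddCommGroup V] [NormedSpace ℝ V]
  {V' : Type*} [NormedAddCommGroup V'] [NormedSpace ℝ V']

namespace SmoothRightAction

variable (ρ : SmoothRightAction E F M S)

theorem continuous_act : Continuous fun q : M × S => ρ.act q.1 q.2 :=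
  ρ.smooth.continuous

/-- The translation of `M` by an element of the group. -/
def actMap (g : S) : C(M, M) :=
  ⟨fun x => ρ.act x g, ρ.continuous_act.comp (continuous_id.prodMk continuous_const)⟩

/-- The representation of the group on the continuous functions on `M`. -/
def koopman : Representation ℝ S C(M, ℝ) where
  toFun g :=
    { toFun f := f.comp (ρ.actMap g)
      map_add' _ _ := rfl
      map_smul' _ _ := rfl }
  map_one' := by
    ext f x
    exact congrArg f (ρ.act_one x)
  map_mul' g h := by
    ext f x
    exact congrArg f (ρ.act_mul x g h)

/-- An invariant mean on the continuous functions on `M`. -/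
structure InvariantMean extends C(M, ℝ) →ₗ[ℝ] ℝ where
  le_of_forall_le' : ∀ (f : C(M, ℝ)) (c : ℝ), (∀ x, f x ≤ c) → toLinearMap f ≤ c
  invariant' : ∀ g f, toLinearMap (ρ.koopman g f) = toLinearMap f

/-- The invariant Hahn–Banach theorem is applied to `f ↦ sup f`, finite by compactness. Translating
`f` cannot increase its supremum, and domination by the supremum encodes both positivity and
normalisation. -/
theorem nonempty_invariantMean [CompactSpace M] [Nonempty M] [Group.IsSolvable S] :
    Nonempty ρ.InvariantMean := by
  have hbdd : ∀ f : C(M, ℝ), BddAbove (Set.range f) := fun f =>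
    (isCompact_range f.continuous).bddAbove
  let p : C(M, ℝ) → ℝ := fun f => ⨆ x, f x
  have hp : IsSublinear p := by
    refine ⟨fun c hc f => (Real.mul_iSup_of_nonneg hc.le _).symm, fun f g => ?_⟩
    exact ciSup_le fun x => add_le_add (le_ciSup (hbdd f) x) (le_ciSup (hbdd g) x)
  obtain ⟨m, hm, hmi⟩ := exists_invariant_le_of_isSolvable ρ.koopman hp
    fun g f => ciSup_le fun x => le_ciSup (hbdd f) (ρ.act x g)
  exact ⟨⟨m, fun f c hf => (hm f).trans (ciSup_le hf), hmi⟩⟩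

namespace InvariantMean

variable {ρ} (m : ρ.InvariantMean)

theorem le_of_forall_le {f : C(M, ℝ)} {c : ℝ} (h : ∀ x, f x ≤ c) : m.toLinearMap f ≤ c :=
  m.le_of_forall_le' f c h

theorem apply_koopman (g : S) (f : C(M, ℝ)) :
    m.toLinearMap (ρ.koopman g f) = m.toLinearMap f := m.invariant' g f

theorem apply_const (c : ℝ) : m.toLinearMap (ContinuousMap.const M c) = c := by
  refine le_antisymm (m.le_of_forall_le fun _ => le_rfl) ?_
  have h := m.le_of_forall_le (f := -ContinuousMap.const M c) (c := -c) fun _ => le_rfl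
  rw [map_neg] at h
  linarith

/-- The mean of a continuous function with values in a finite-dimensional space. -/
noncomputable def vectorMean [FiniteDimensional ℝ V] : C(M, V) →ₗ[ℝ] V :=
  ∑ i, (m.toLinearMap ∘ₗ (((Module.finBasis ℝ V).coord i).toContinuousLinearMap.compLeftContinuous
    ℝ M).toLinearMap).smulRight (Module.finBasis ℝ V i)

variable [FiniteDimensional ℝ V] [FiniteDimensional ℝ V']

/-- Linear forms commute with the mean. This characterises `vectorMean` without the basis chosen in
its definition and reduces vector-valued claims to scalar ones. -/
theorem dual_vectorMean (φ : V →ₗ[ℝ] ℝ) (f : C(M, V)) {g : C(M, ℝ)} (h : ∀ x, g x = φ (f x)) :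
    φ (m.vectorMean f) = m.toLinearMap g := by
  have hg : g = ∑ i, φ (Module.finBasis ℝ V i) •
      ((Module.finBasis ℝ V).coord i).toContinuousLinearMap.compLeftContinuous ℝ M f := by
    ext x
    rw [h]
    conv_lhs => rw [← (Module.finBasis ℝ V).sum_repr (f x), map_sum]
    simp [mul_comm]
  rw [hg]
  simp [vectorMean, mul_comm]

theorem eq_vectorMean_of_dual {f : C(M, V)} {v : V}
    (h : ∀ φ : V →L[ℝ] ℝ, φ v = m.toLinearMap ((φ : C(V, ℝ)).comp f)) : m.vectorMean f = v := by
  refine (SeparatingDual.eq_iff_forall_dual_eq (R := ℝ)).2 fun φ => ?_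
  rw [h]
  exact m.dual_vectorMean φ.toLinearMap f fun _ => rfl

theorem vectorMean_const (v : V) : m.vectorMean (ContinuousMap.const M v) = v :=
  m.eq_vectorMean_of_dual fun φ => (m.apply_const (φ v)).symm

theorem vectorMean_map (T : V →ₗ[ℝ] V') (f : C(M, V)) {g : C(M, V')} (h : ∀ x, g x = T (f x)) :
    m.vectorMean g = T (m.vectorMean f) := by
  refine m.eq_vectorMean_of_dual fun φ => ?_
  exact m.dual_vectorMean (φ.toLinearMap ∘ₗ T) f fun x => congrArg φ (h x)

end InvariantMean

/-- Continuous functions are uniformly close to their translates by small group elements. -/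
theorem eventually_forall_abs_sub_lt [CompactSpace M] (f : C(M, ℝ)) {ε : ℝ} (hε : 0 < ε) :
    ∀ᶠ g in 𝓝 (1 : S), ∀ x, |f (ρ.act x g) - f x| < ε := by
  -- Currying turns joint continuity into continuity of `g ↦ f (· g)` for the compact-open topology,
  -- which on compact `M` is that of the supremum norm.
  let Φ : C(S, C(M, ℝ)) := ContinuousMap.curry
    ⟨fun q : S × M => f (ρ.act q.2 q.1), f.continuous.comp (ρ.continuous_act.comp continuous_swap)⟩
  have h := Metric.continuousAt_iff'.1 (Φ.continuous.continuousAt (x := (1 : S))) ε hε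
  filter_upwards [h] with g hg x
  have h1 := (ContinuousMap.dist_lt_iff hε).1 hg x
  have h2 : Φ 1 x = f x := congrArg f (ρ.act_one x)
  rw [h2] at h1
  exact h1

/-- A curve in the group that is tangent to a left invariant vector field. -/
theorem exists_integralCurve [LieGroup 𝓘(ℝ, F) ∞ S] [FiniteDimensional ℝ F]
    (v : GroupLieAlgebra 𝓘(ℝ, F) S) : ∃ γ : ℝ → S, γ 0 = 1 ∧
      IsMIntegralCurveAt γ (mulInvariantVectorField (I := 𝓘(ℝ, F)) v) 0 := by
  have : IsManifold 𝓘(ℝ, F) 1 S := .of_le (n := ∞) (by simp)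
  have hsm : ContMDiffAt 𝓘(ℝ, F) (𝓘(ℝ, F).prod 𝓘(ℝ, F)) 1
      (fun g : S => (⟨g, mulInvariantVectorField v g⟩ : TangentBundle 𝓘(ℝ, F) S)) 1 :=
    ((translation (F := F) S).smooth_combination (a := fun _ => v) contMDiffAt_const).of_le
      (by simp)
  exact exists_isMIntegralCurveAt_of_contMDiffAt_boundaryless 0 hsm

section

variable [IsManifold 𝓘(ℝ, E) ∞ M] [LieGroup 𝓘(ℝ, F) ∞ S]

/-- The chain rule, together with the fact that orbit maps carry left invariant fields to
fundamental fields. -/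
theorem hasDerivAt_comp_act {f : M → ℝ} (hf : ContMDiff 𝓘(ℝ, E) 𝓘(ℝ, ℝ) ∞ f)
    {v : GroupLieAlgebra 𝓘(ℝ, F) S} {γ : ℝ → S} {t : ℝ}
    (ht : HasMFDerivAt 𝓘(ℝ, ℝ) 𝓘(ℝ, F) γ t
      ((1 : ℝ →L[ℝ] ℝ).smulRight (mulInvariantVectorField (I := 𝓘(ℝ, F)) v (γ t)))) (x : M) :
    HasDerivAt (fun t => f (ρ.act x (γ t)))
      (mfderiv 𝓘(ℝ, E) 𝓘(ℝ, ℝ) f (ρ.act x (γ t)) (ρ.orbitDeriv (ρ.act x (γ t)) v) : ℝ) t := by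
  have h1 := ((ρ.smooth_orbit x).mdifferentiable (by simp) (γ t)).hasMFDerivAt.comp t ht
  have h2 := (hf.mdifferentiable (by simp) (ρ.act x (γ t))).hasMFDerivAt.comp t h1
  have h3 : HasFDerivAt (fun t => f (ρ.act x (γ t))) (_ : ℝ →L[ℝ] ℝ) t :=
    hasMFDerivAt_iff_hasFDerivAt.1 h2
  refine h3.hasDerivAt.congr_deriv ?_
  have h4 : (mfderiv 𝓘(ℝ, F) 𝓘(ℝ, E) (fun h => ρ.act x h) (γ t)
      ((1 : ℝ) • (mulInvariantVectorField v (γ t) : F)) : E) = ρ.orbitDeriv (ρ.act x (γ t)) v := by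
    rw [one_smul]
    exact ρ.mfderiv_orbit_mulInvariant x (γ t) v
  exact congrArg (fun w : E => (mfderiv 𝓘(ℝ, E) 𝓘(ℝ, ℝ) f (ρ.act x (γ t)) w : ℝ)) h4

-- The derivative is a uniform limit of the difference quotients of `f` along the action, and each
-- quotient has mean zero by invariance. A local integral curve of the left invariant field is
-- enough; no one-parameter subgroup is required.
variable {ρ} in
theorem InvariantMean.apply_eq_zero_of_eq_deriv [CompactSpace M] [FiniteDimensional ℝ F]
    (m : ρ.InvariantMean) {f : M → ℝ} (hf : ContMDiff 𝓘(ℝ, E) 𝓘(ℝ, ℝ) ∞ f)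
    (v : GroupLieAlgebra 𝓘(ℝ, F) S) {f' : C(M, ℝ)}
    (hf' : ∀ x, f' x = (mfderiv 𝓘(ℝ, E) 𝓘(ℝ, ℝ) f x (ρ.orbitDeriv x v) : ℝ)) :
    m.toLinearMap f' = 0 := by
  obtain ⟨γ, hγ0, hγ⟩ := exists_integralCurve (S := S) v
  have key : ∀ ε : ℝ, 0 < ε → |m.toLinearMap f'| ≤ ε := by
    intro ε hε
    have hnear : ∀ᶠ t in 𝓝 (0 : ℝ), ∀ x, |f' (ρ.act x (γ t)) - f' x| < ε := by
      have hc : Filter.Tendsto γ (𝓝 0) (𝓝 1) := by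
        have := hγ.continuousAt
        rwa [ContinuousAt, hγ0] at this
      exact hc.eventually (ρ.eventually_forall_abs_sub_lt f' hε)
    obtain ⟨δ, hδ, hball⟩ := Metric.eventually_nhds_iff.1 (hγ.and hnear)
    set t := δ / 2 with ht
    have htpos : 0 < t := by positivity
    have hI : ∀ s ∈ Set.Icc 0 t, dist s 0 < δ := by
      intro s hs
      rw [Real.dist_eq, sub_zero, abs_of_nonneg hs.1]
      linarith [hs.2]
    -- Mean value inequality for `s ↦ f (x · γ s) - s f' x`, whose derivative `f' (x · γ s) - f' x`
    -- is below `ε` in absolute value, uniformly in `x`.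
    have hmv : ∀ x, |f (ρ.act x (γ t)) - f x - t * f' x| ≤ ε * t := by
      intro x
      have hd : ∀ s ∈ Set.Icc 0 t, HasDerivWithinAt (fun s => f (ρ.act x (γ s)) - s * f' x)
          (f' (ρ.act x (γ s)) - f' x) (Set.Icc 0 t) s := by
        intro s hs
        have h1 := ρ.hasDerivAt_comp_act hf (hball (hI s hs)).1 x
        rw [← hf'] at h1
        have h2 := h1.sub ((hasDerivAt_id s).mul_const (f' x))
        rw [one_mul] at h2
        exact h2.hasDerivWithinAt
      have h3 := (convex_Icc 0 t).norm_image_sub_le_of_norm_hasDerivWithin_le hd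
        (fun s hs => ((hball (hI s hs)).2 x).le) (Set.left_mem_Icc.2 htpos.le)
        (Set.right_mem_Icc.2 htpos.le)
      rw [hγ0, ρ.act_one, zero_mul, sub_zero, sub_zero, Real.norm_eq_abs, Real.norm_eq_abs,
        abs_of_pos htpos] at h3
      rwa [sub_right_comm]
    let fc : C(M, ℝ) := ⟨f, hf.continuous⟩
    have h1 := m.le_of_forall_le (f := ρ.koopman (γ t) fc - fc - t • f') (c := ε * t)
      fun x => (abs_le.1 (hmv x)).2
    have h2 := m.le_of_forall_le (f := -(ρ.koopman (γ t) fc - fc - t • f')) (c := ε * t)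
      fun x => neg_le.1 (abs_le.1 (hmv x)).1
    -- By invariance the translate of `f` and `f` itself cancel, leaving `|t * m f'| ≤ ε * t`.
    simp only [map_neg, map_sub, map_smul, m.apply_koopman, smul_eq_mul] at h1 h2
    rw [abs_le]
    constructor <;> nlinarith
  by_contra h
  have := key _ (half_pos (abs_pos.2 h))
  linarith [abs_pos.2 h]

/-- The mean of a derivative along a fundamental vector field vanishes. -/
theorem InvariantMean.vectorMean_eq_zero_of_eq_deriv {ρ : SmoothRightAction E F M S}
    [CompactSpace M] [FiniteDimensional ℝ F] [FiniteDimensional ℝ V]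
    (m : ρ.InvariantMean) {f : M → V} (hf : ContMDiff 𝓘(ℝ, E) 𝓘(ℝ, V) ∞ f)
    (v : GroupLieAlgebra 𝓘(ℝ, F) S) {f' : C(M, V)}
    (hf' : ∀ x, f' x = (mfderiv 𝓘(ℝ, E) 𝓘(ℝ, V) f x (ρ.orbitDeriv x v) : V)) :
    m.vectorMean f' = 0 := by
  refine m.eq_vectorMean_of_dual fun φ => ?_
  rw [map_zero]
  refine (m.apply_eq_zero_of_eq_deriv (φ.contMDiff.comp hf) v fun x => ?_).symm
  have h1 := mfderiv_comp x (φ.contMDiff (n := ∞).mdifferentiable (by simp) (f x))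
    (hf.mdifferentiable (by simp) x)
  rw [φ.mfderiv_eq] at h1
  refine Eq.trans ?_ (congrArg (fun T : E →L[ℝ] ℝ => T (ρ.orbitDeriv x v)) h1).symm
  exact congrArg φ (hf' x)

end

end SmoothRightAction

end InvariantMean

/-! ### Brackets of combinations of fundamental vector fields -/

section StructureEquation

open VectorField

variable {E : Type*} [NormedAddCommGroup E] [NormedSpace ℝ E] [FiniteDimensional ℝ E]
  {F : Type*} [NormedAddCommGroup F] [NormedSpace ℝ F] [FiniteDimensional ℝ F]
  {M : Type*} [TopologicalSpace M] [ChartedSpace E M] [IsManifold 𝓘(ℝ, E) ∞ M]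
  {S : Type*} [TopologicalSpace S] [ChartedSpace F S] [Group S] [LieGroup 𝓘(ℝ, F) ∞ S]

namespace SmoothRightAction

variable (ρ : SmoothRightAction E F M S)

/-- The derivative of the orbit map at the identity, on the model space of the Lie algebra. -/
noncomputable def anchor (x : M) : F →L[ℝ] TangentSpace 𝓘(ℝ, E) x := ρ.orbitDeriv x

theorem mdifferentiable_combination {a : M → F} (ha : ContMDiff 𝓘(ℝ, E) 𝓘(ℝ, F) ∞ a) :
    MDifferentiable 𝓘(ℝ, E) (𝓘(ℝ, E).prod 𝓘(ℝ, E))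
      (fun x => (⟨x, ρ.anchor x (a x)⟩ : TangentBundle 𝓘(ℝ, E) M)) := fun x =>
  (ρ.smooth_combination (ha x)).mdifferentiableAt (by simp)

/-- The map from the Lie algebra to vector fields is a homomorphism. -/
theorem mlieBracket_orbitDeriv_const (v w : GroupLieAlgebra 𝓘(ℝ, F) S) (x : M) :
    mlieBracket 𝓘(ℝ, E) (fun y => ρ.orbitDeriv y v) (fun y => ρ.orbitDeriv y w) x =
      ρ.orbitDeriv x ⁅v, w⁆ := by
  -- The orbit map of `x` relates left invariant fields on `S` to fundamental fields on `M`; at the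
  -- identity the bracket of the former is the Lie algebra bracket.
  have key := mfderiv_mlieBracket_of_related (ρ.smooth_orbit x) (1 : S)
    ((translation (F := F) S).mdifferentiable_combination (a := fun _ => v) contMDiff_const 1)
    ((translation (F := F) S).mdifferentiable_combination (a := fun _ => w) contMDiff_const 1)
    (ρ.mdifferentiable_combination (a := fun _ => v) contMDiff_const _)
    (ρ.mdifferentiable_combination (a := fun _ => w) contMDiff_const _)
    (fun g => ρ.mfderiv_orbit_mulInvariant x g v)
    (fun g => ρ.mfderiv_orbit_mulInvariant x g w)
  have htransport : ∀ y : M, y = x →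
      (mlieBracket 𝓘(ℝ, E) (fun y => ρ.orbitDeriv y v) (fun y => ρ.orbitDeriv y w) y : E) =
      mlieBracket 𝓘(ℝ, E) (fun y => ρ.orbitDeriv y v) (fun y => ρ.orbitDeriv y w) x := by
    rintro y rfl
    rfl
  exact (htransport _ (ρ.act_one x)).symm.trans key.symm

/-- The Leibniz rule for a single coefficient. The undifferentiated term is written with the
coefficient frozen at `x`, a form that is additive in the coefficient function and so extends to
`F`-valued ones. -/
theorem mlieBracket_anchor_smul (Y : Π x : M, TangentSpace 𝓘(ℝ, E) x) {r : M → ℝ} {x : M}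
    (hr : MDifferentiableAt 𝓘(ℝ, E) 𝓘(ℝ, ℝ) r x) (u : F) :
    mlieBracket 𝓘(ℝ, E) Y (fun y => ρ.anchor y (r y • u)) x =
      ρ.anchor x (mvfderiv 𝓘(ℝ, E) (fun y => r y • u) x (Y x)) +
        mlieBracket 𝓘(ℝ, E) Y (fun y => ρ.anchor y (r x • u)) x := by
  have : IsManifold 𝓘(ℝ, E) 2 M := .of_le (n := ∞) (by exact ENat.LEInfty.out)
  have hu := ρ.mdifferentiable_combination (contMDiff_const (c := u)) x
  have e1 := mlieBracket_smul_right (V := Y) hr hu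
  have e2 := mlieBracket_const_smul_right (V := Y) (c := r x) hu
  have f1 : (r • fun y => ρ.anchor y u) = fun y => ρ.anchor y (r y • u) :=
    funext fun y => (map_smul _ _ _).symm
  have f2 : (r x • fun y => ρ.anchor y u) = fun y => ρ.anchor y (r x • u) :=
    funext fun y => (map_smul _ _ _).symm
  have e3 := mvfderiv_fun_smul hr
    (mdifferentiableAt_const (I := 𝓘(ℝ, E)) (I' := 𝓘(ℝ, F)) (x := x) (c := u))
  rw [mvfderiv_const, smul_zero, zero_add] at e3
  rw [f1] at e1
  rw [f2] at e2
  rw [e3, ContinuousLinearMap.smulRight_apply, map_smul, e1, e2]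

/-- The Leibniz rule for the bracket with a combination of fundamental vector fields. -/
theorem mlieBracket_anchor_right (Y : Π x : M, TangentSpace 𝓘(ℝ, E) x) {a : M → F}
    (ha : ContMDiff 𝓘(ℝ, E) 𝓘(ℝ, F) ∞ a) (x : M) :
    mlieBracket 𝓘(ℝ, E) Y (fun y => ρ.anchor y (a y)) x =
      ρ.anchor x (mvfderiv 𝓘(ℝ, E) a x (Y x)) +
        mlieBracket 𝓘(ℝ, E) Y (fun y => ρ.anchor y (a x)) x := by
  have : IsManifold 𝓘(ℝ, E) 2 M := .of_le (n := ∞) (by exact ENat.LEInfty.out)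
  let b := Module.finBasis ℝ F
  -- Smoothness joins the claim so that the induction over the basis expansion can use additivity of
  -- bracket and derivative.
  suffices H : ContMDiff 𝓘(ℝ, E) 𝓘(ℝ, F) ∞ a ∧
      mlieBracket 𝓘(ℝ, E) Y (fun y => ρ.anchor y (a y)) x =
      ρ.anchor x (mvfderiv 𝓘(ℝ, E) a x (Y x)) +
        mlieBracket 𝓘(ℝ, E) Y (fun y => ρ.anchor y (a x)) x from H.2
  have hsum : a = ∑ i, fun y => b.repr (a y) i • b i := by
    funext y
    rw [Finset.sum_apply]
    exact (b.sum_repr (a y)).symm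
  have hcoord : ∀ i, ContMDiff 𝓘(ℝ, E) 𝓘(ℝ, ℝ) ∞ fun y => b.repr (a y) i := fun i =>
    (LinearMap.toContinuousLinearMap (b.coord i)).contMDiff.comp ha
  rw [hsum]
  refine Finset.sum_induction _ (fun a : M → F => ContMDiff 𝓘(ℝ, E) 𝓘(ℝ, F) ∞ a ∧
      mlieBracket 𝓘(ℝ, E) Y (fun y => ρ.anchor y (a y)) x =
      ρ.anchor x (mvfderiv 𝓘(ℝ, E) a x (Y x)) +
        mlieBracket 𝓘(ℝ, E) Y (fun y => ρ.anchor y (a x)) x) ?_ ?_ ?_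
  · rintro a c ⟨ha, hae⟩ ⟨hc, hce⟩
    refine ⟨ha.add hc, ?_⟩
    have e1 := mlieBracket_add_right (V := Y) (ρ.mdifferentiable_combination ha x)
      (ρ.mdifferentiable_combination hc x)
    have e2 := mlieBracket_add_right (V := Y)
      (ρ.mdifferentiable_combination (contMDiff_const (c := a x)) x)
      (ρ.mdifferentiable_combination (contMDiff_const (c := c x)) x)
    have f1 : (fun y => ρ.anchor y (a y)) + (fun y => ρ.anchor y (c y)) =
        fun y => ρ.anchor y ((a + c) y) := funext fun y => (map_add _ _ _).symm
    have f2 : (fun y => ρ.anchor y (a x)) + (fun y => ρ.anchor y (c x)) =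
        fun y => ρ.anchor y ((a + c) x) := funext fun y => (map_add _ _ _).symm
    rw [f1] at e1
    rw [f2] at e2
    rw [e1, e2, hae, hce, mvfderiv_add (ha.mdifferentiable (by simp) x)
      (hc.mdifferentiable (by simp) x), add_apply, map_add]
    abel
  · refine ⟨contMDiff_const, ?_⟩
    have f1 : (fun y => ρ.anchor y ((0 : M → F) y)) = 0 := funext fun y => map_zero _
    have f2 : (fun y => ρ.anchor y ((0 : M → F) x)) = 0 := funext fun y => map_zero _
    rw [f1, f2, mvfderiv_zero, zero_apply, map_zero, zero_add]
  · intro i _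
    refine ⟨(hcoord i).smul contMDiff_const, ?_⟩
    exact ρ.mlieBracket_anchor_smul Y ((hcoord i).mdifferentiable (by simp) x) (b i)

/-- The structure equation. -/
theorem mlieBracket_anchor {a c : M → F} (ha : ContMDiff 𝓘(ℝ, E) 𝓘(ℝ, F) ∞ a)
    (hc : ContMDiff 𝓘(ℝ, E) 𝓘(ℝ, F) ∞ c) (x : M) {v w : GroupLieAlgebra 𝓘(ℝ, F) S}
    (hv : a x = v) (hw : c x = w) :
    mlieBracket 𝓘(ℝ, E) (fun y => ρ.anchor y (a y)) (fun y => ρ.anchor y (c y)) x =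
      ρ.anchor x (mvfderiv 𝓘(ℝ, E) c x (ρ.orbitDeriv x v)) -
        ρ.anchor x (mvfderiv 𝓘(ℝ, E) a x (ρ.orbitDeriv x w)) + ρ.orbitDeriv x ⁅v, w⁆ := by
  -- The coefficients are frozen one slot at a time, with antisymmetry in between, until the bracket
  -- of two fundamental fields remains.
  have h1 := ρ.mlieBracket_anchor_right (fun y => ρ.anchor y (a y)) hc x
  have h2 := ρ.mlieBracket_anchor_right (fun y => ρ.anchor y (c x)) ha x
  have h3 : mlieBracket 𝓘(ℝ, E) (fun y => ρ.anchor y (c x)) (fun y => ρ.anchor y (a x)) x =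
      ρ.orbitDeriv x ⁅w, v⁆ := by
    rw [hv, hw]
    exact ρ.mlieBracket_orbitDeriv_const w v x
  have h4 : mlieBracket 𝓘(ℝ, E) (fun y => ρ.anchor y (a y)) (fun y => ρ.anchor y (c x)) x =
    -mlieBracket 𝓘(ℝ, E) (fun y => ρ.anchor y (c x)) (fun y => ρ.anchor y (a y)) x :=
    mlieBracket_swap_apply
  have h5 : ρ.orbitDeriv x ⁅w, v⁆ = -ρ.orbitDeriv x ⁅v, w⁆ := by
    rw [← lie_skew, map_neg]
  have h6 : ρ.anchor x (a x) = ρ.orbitDeriv x v := by rw [hv]; rfl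
  have h7 : ρ.anchor x (c x) = ρ.orbitDeriv x w := by rw [hw]; rfl
  rw [h1, h4, h2, h3, h5, h6, h7]
  abel

end SmoothRightAction

end StructureEquation

/-- The cancellation behind the compatibility of the Chevalley–Eilenberg formula with pullbacks:
in `c i j` one thinks of the derivative of the `j`-th argument along the `i`-th one. -/
theorem sum_update_succAbove_eq_zero {L W : Type*} [AddCommGroup L] [Module ℝ L]
    [AddCommGroup W] [Module ℝ W] {p : ℕ} (φ : L [⋀^Fin p]→ₗ[ℝ] W) (X : Fin (p + 1) → L)
    (c : Fin (p + 1) → Fin (p + 1) → L) :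
    ∑ i : Fin (p + 1), (-1 : ℤ) ^ (i : ℕ) • ∑ k : Fin p,
        φ (Function.update (fun k => X (i.succAbove k)) k (c i (i.succAbove k))) +
      ∑ i : Fin (p + 1), ∑ j ∈ Finset.Ioi i, (-1 : ℤ) ^ (j : ℕ) •
        (φ (fun k => Function.update X i (c i j) (j.succAbove k)) -
          φ (fun k => Function.update X i (c j i) (j.succAbove k))) = 0 := by
  -- The first sum is the sum of `G i l` over all `i ≠ l`. For `i < j`, the subtracted term of the
  -- second sum is exactly `G j i`, and its other term cancels `G i j` by alternation.
  set G : Fin (p + 1) → Fin (p + 1) → W := fun i l =>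
    (-1 : ℤ) ^ (i : ℕ) • φ (fun k => Function.update X l (c i l) (i.succAbove k)) with hG
  have h1 : ∀ i : Fin (p + 1), (-1 : ℤ) ^ (i : ℕ) • ∑ k : Fin p,
      φ (Function.update (fun k => X (i.succAbove k)) k (c i (i.succAbove k))) =
      ∑ l ∈ Finset.Ioi i, G i l + ∑ l ∈ Finset.Iio i, G i l := by
    intro i
    have h2 : ∀ k : Fin p, (-1 : ℤ) ^ (i : ℕ) •
        φ (Function.update (fun k => X (i.succAbove k)) k (c i (i.succAbove k))) =
        G i (i.succAbove k) := by
      intro k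
      simp only [hG]
      congr 2
      exact (Function.update_comp_eq_of_injective X Fin.succAbove_right_injective k _).symm
    rw [Finset.smul_sum, Finset.sum_congr rfl fun k _ => h2 k]
    have h3 : ∑ k : Fin p, G i (i.succAbove k) = ∑ l ∈ Finset.univ.erase i, G i l := by
      have h := Finset.add_sum_erase Finset.univ (G i) (Finset.mem_univ i)
      rw [Fin.sum_univ_succAbove _ i] at h
      exact (add_left_cancel h).symm
    rw [h3, ← Finset.sum_union (Finset.disjoint_left.2 fun l hl hl' => by
      simp only [Finset.mem_Ioi, Finset.mem_Iio] at hl hl'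
      exact lt_asymm hl hl')]
    refine Finset.sum_congr (Finset.ext fun l => ?_) fun _ _ => rfl
    simp only [Finset.mem_erase, Finset.mem_univ, Finset.mem_union, Finset.mem_Ioi,
      Finset.mem_Iio, and_true]
    rw [ne_comm]
    exact lt_or_lt_iff_ne.symm
  have h4 : ∑ i : Fin (p + 1), ∑ l ∈ Finset.Iio i, G i l =
      ∑ i : Fin (p + 1), ∑ j ∈ Finset.Ioi i, G j i :=
    Finset.sum_comm' (by simp)
  rw [Finset.sum_congr rfl fun i _ => h1 i, Finset.sum_add_distrib, h4, ← Finset.sum_add_distrib,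
    ← Finset.sum_add_distrib]
  refine Finset.sum_eq_zero fun i _ => ?_
  rw [← Finset.sum_add_distrib, ← Finset.sum_add_distrib]
  refine Finset.sum_eq_zero fun j hj => ?_
  have hij : i ≠ j := (Finset.mem_Ioi.1 hj).ne
  -- With `c i j` placed in both slots `i` and `j`, deleting either one gives the two arguments to
  -- be compared, and alternation supplies the sign.
  have h5 := φ.neg_one_pow_smul_map_removeNth_add_eq_zero_of_eq
    (v := Function.update (Function.update X i (c i j)) j (c i j)) (i := i) (j := j)
    (by rw [Function.update_self, Function.update_of_ne hij, Function.update_self]) hij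
  have h6 : j.removeNth (Function.update (Function.update X i (c i j)) j (c i j)) =
      fun k => Function.update X i (c i j) (j.succAbove k) := by
    funext k
    exact Function.update_of_ne (Fin.succAbove_ne j k) _ _
  have h7 : i.removeNth (Function.update (Function.update X i (c i j)) j (c i j)) =
      fun k => Function.update X j (c i j) (i.succAbove k) := by
    funext k
    rw [Function.update_comm hij]
    exact Function.update_of_ne (Fin.succAbove_ne i k) _ _
  rw [h6, h7] at h5
  simp only [hG, smul_sub]
  rw [add_add_sub_cancel]
  exact h5

/-! ### Pullback by the canonical form commutes with the differentials -/

section Leafwise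

variable {E : Type*} [NormedAddCommGroup E] [NormedSpace ℝ E] [FiniteDimensional ℝ E]
  {F : Type*} [NormedAddCommGroup F] [NormedSpace ℝ F] [FiniteDimensional ℝ F]
  {M : Type*} [TopologicalSpace M] [ChartedSpace E M] [IsManifold 𝓘(ℝ, E) ∞ M]
  {S : Type*} [TopologicalSpace S] [ChartedSpace F S] [Group S] [LieGroup 𝓘(ℝ, F) ∞ S]
  {V : Type*} [NormedAddCommGroup V] [NormedSpace ℝ V]

/-- The product rule for multilinear maps. -/
theorem mvfderiv_multilinear {p : ℕ} (f : MultilinearMap ℝ (fun _ : Fin p => F) V)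
    {a : Fin p → M → F} (ha : ∀ k, ContMDiff 𝓘(ℝ, E) 𝓘(ℝ, F) ∞ (a k)) (x : M)
    (w : TangentSpace 𝓘(ℝ, E) x) :
    mvfderiv 𝓘(ℝ, E) (fun x => f fun k => a k x) x w =
      ∑ k, f (Function.update (fun k => a k x) k (mvfderiv 𝓘(ℝ, E) (a k) x w)) := by
  -- Continuity of `f` is its smoothness as a function of the coordinate projections of `Fin p → F`.
  let fc : ContinuousMultilinearMap ℝ (fun _ : Fin p => F) V :=
    ⟨f, (contMDiff_multilinear (M := Fin p → F) (E := Fin p → F) f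
      fun k => (ContinuousLinearMap.proj (R := ℝ) (φ := fun _ : Fin p => F) k).contMDiff).continuous⟩
  have h1 : ∀ k, HasMFDerivAt 𝓘(ℝ, E) 𝓘(ℝ, F) (a k) x (mvfderiv 𝓘(ℝ, E) (a k) x) := fun k =>
    ((ha k).mdifferentiable (by simp) x).hasMFDerivAt
  let T : Fin p → E →L[ℝ] V := fun k =>
    (fc.toContinuousLinearMap (fun j => a j x) k) ∘L (mvfderiv 𝓘(ℝ, E) (a k) x : E →L[ℝ] F)
  have h2 : HasMFDerivAt 𝓘(ℝ, E) 𝓘(ℝ, V) (fun x => f fun k => a k x) x (∑ k, T k) := by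
    refine ⟨(contMDiff_multilinear f ha).continuous.continuousAt, ?_⟩
    have h3 := HasFDerivWithinAt.multilinear_comp (f := fc) fun k => (h1 k).2
    have hx : ∀ k, writtenInExtChartAt 𝓘(ℝ, E) 𝓘(ℝ, F) x (a k) (extChartAt 𝓘(ℝ, E) x x) = a k x :=
      fun k => by simp [chartAt_self_eq]
    simp only [hx] at h3
    exact h3
  have h4 := congrArg (fun T : E →L[ℝ] V => T w) h2.mfderiv
  have h5 : ∀ u : E, (∑ k, T k) u = ∑ k, T k u := fun u => by simp
  exact Eq.trans h4 (h5 w)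

namespace LocallyFreeAction

variable {ρ : LocallyFreeAction E F M S}

/-- The `𝔰`-valued function `ω₀(X)`, with values in the model space. -/
noncomputable def coefficient (X : ρ.LeafwiseField) (x : M) : F := ρ.canonicalForm x (X.toFun x)

theorem contMDiff_coefficient (X : ρ.LeafwiseField) :
    ContMDiff 𝓘(ℝ, E) 𝓘(ℝ, F) ∞ (coefficient X) := smooth_canonicalForm X

theorem canonicalForm_orbitDeriv (x : M) (v : GroupLieAlgebra 𝓘(ℝ, F) S)
    {u : ρ.leafTangent x} (hu : (u : TangentSpace 𝓘(ℝ, E) x) = ρ.orbitDeriv x v) :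
    ρ.canonicalForm x u = v :=
  ρ.orbitDeriv_injective ρ.locallyFree x ((ρ.orbitDeriv_canonicalForm x u).trans hu)

/-- The derivative of `ω₀(Y)` along `X`. -/
noncomputable def coefficientDeriv (X Y : ρ.LeafwiseField) (x : M) : GroupLieAlgebra 𝓘(ℝ, F) S :=
  mvfderiv 𝓘(ℝ, E) (coefficient Y) x (X.toFun x : TangentSpace 𝓘(ℝ, E) x)

/-- The structure equation of the canonical form. -/
theorem canonicalForm_fieldBracket (X Y : ρ.LeafwiseField) (x : M) :
    ρ.canonicalForm x ((ρ.fieldBracket X Y).toFun x) =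
      coefficientDeriv X Y x - coefficientDeriv Y X x +
        ⁅ρ.canonicalForm x (X.toFun x), ρ.canonicalForm x (Y.toFun x)⁆ := by
  refine canonicalForm_orbitDeriv x _ ?_
  have hX : (fun y => (X.toFun y : TangentSpace 𝓘(ℝ, E) y)) =
      fun y => ρ.anchor y (coefficient X y) :=
    funext fun y => (ρ.orbitDeriv_canonicalForm y (X.toFun y)).symm
  have hY : (fun y => (Y.toFun y : TangentSpace 𝓘(ℝ, E) y)) =
      fun y => ρ.anchor y (coefficient Y y) :=
    funext fun y => (ρ.orbitDeriv_canonicalForm y (Y.toFun y)).symm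
  have h := ρ.mlieBracket_anchor (contMDiff_coefficient X) (contMDiff_coefficient Y) x
    (v := ρ.canonicalForm x (X.toFun x)) (w := ρ.canonicalForm x (Y.toFun x)) rfl rfl
  rw [← hX, ← hY, ρ.orbitDeriv_canonicalForm, ρ.orbitDeriv_canonicalForm] at h
  refine h.trans ?_
  rw [map_add, map_sub]
  rfl

/-- The pullback by the canonical form commutes with the differentials. -/
theorem covariantDifferential_pullback (π : LieRep (GroupLieAlgebra 𝓘(ℝ, F) S) V) {p : ℕ}
    (φ : LieCochain (GroupLieAlgebra 𝓘(ℝ, F) S) V p) (X : Fin (p + 1) → ρ.LeafwiseField) (x : M) :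
    ρ.covariantDifferential π p (ρ.pullback V p φ) X x =
      lieDifferential π p φ fun i => ρ.canonicalForm x ((X i).toFun x) := by
  set a : Fin (p + 1) → GroupLieAlgebra 𝓘(ℝ, F) S := fun i => ρ.canonicalForm x ((X i).toFun x)
    with ha
  have h1 : ∀ i : Fin (p + 1), covariantDeriv π (X i)
      (ρ.formEval V p (ρ.pullback V p φ) fun k => X (i.succAbove k)) x =
      ∑ k, φ (Function.update (fun k => a (i.succAbove k)) k
        (coefficientDeriv (X i) (X (i.succAbove k)) x)) + π (a i) (φ fun k => a (i.succAbove k)) := by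
    intro i
    exact congrArg (· + π (a i) (φ fun k => a (i.succAbove k)))
      (mvfderiv_multilinear (F := F) φ.toMultilinearMap
        (fun k => contMDiff_coefficient (X (i.succAbove k))) x ((X i).toFun x))
  have h2 : ∀ i j : Fin (p + 1), i ≠ j → ρ.formEval V p (ρ.pullback V p φ)
      (fun k => Function.update X i (ρ.fieldBracket (X i) (X j)) (j.succAbove k)) x =
      φ (fun k => Function.update a i (coefficientDeriv (X i) (X j) x) (j.succAbove k)) -
      φ (fun k => Function.update a i (coefficientDeriv (X j) (X i) x) (j.succAbove k)) +
      φ (fun k => Function.update a i ⁅a i, a j⁆ (j.succAbove k)) := by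
    intro i j hij
    -- As `i ≠ j`, slot `i` survives the omission of `j`. The structure equation can then be
    -- expanded in that slot by multilinearity.
    obtain ⟨k₀, rfl⟩ := Fin.exists_succAbove_eq hij
    have h3 : ∀ z : GroupLieAlgebra 𝓘(ℝ, F) S,
        (fun k => Function.update a (j.succAbove k₀) z (j.succAbove k)) =
        Function.update (fun k => a (j.succAbove k)) k₀ z := fun z =>
      Function.update_comp_eq_of_injective a Fin.succAbove_right_injective k₀ z
    have h4 : (fun k => ρ.canonicalForm x ((Function.update X (j.succAbove k₀)
        (ρ.fieldBracket (X (j.succAbove k₀)) (X j)) (j.succAbove k)).toFun x)) =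
        Function.update (fun k => a (j.succAbove k)) k₀ (ρ.canonicalForm x
          ((ρ.fieldBracket (X (j.succAbove k₀)) (X j)).toFun x)) := by
      rw [← h3]
      funext k
      exact Function.apply_update (fun _ (Z : ρ.LeafwiseField) => ρ.canonicalForm x (Z.toFun x))
        X (j.succAbove k₀) _ (j.succAbove k)
    rw [h3, h3, h3, ← φ.map_update_sub, ← φ.map_update_add, ← canonicalForm_fieldBracket, ← h4]
    rfl
  have h5 := sum_update_succAbove_eq_zero φ a fun i j => coefficientDeriv (X i) (X j) x
  have h6 : ρ.covariantDifferential π p (ρ.pullback V p φ) X x =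
      ∑ i : Fin (p + 1), (-1 : ℤ) ^ (i : ℕ) • covariantDeriv π (X i)
        (ρ.formEval V p (ρ.pullback V p φ) fun k => X (i.succAbove k)) x +
      ∑ i : Fin (p + 1), ∑ j ∈ Finset.Ioi i, (-1 : ℤ) ^ (j : ℕ) •
        ρ.formEval V p (ρ.pullback V p φ)
          (fun k => Function.update X i (ρ.fieldBracket (X i) (X j)) (j.succAbove k)) x := by
    change koszul ρ.fieldBracket (covariantDeriv π) (ρ.formEval V p (ρ.pullback V p φ)) X x = _
    simp only [koszul, Pi.add_apply, Finset.sum_apply, Pi.smul_apply]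
  rw [h6, Finset.sum_congr rfl fun i _ => by rw [h1 i], Finset.sum_congr rfl fun i _ =>
    Finset.sum_congr rfl fun j hj => by rw [h2 i j (Finset.mem_Ioi.1 hj).ne]]
  simp only [smul_add, Finset.sum_add_distrib]
  -- All derivatives of the coefficients cancel; what remains is the Chevalley–Eilenberg formula at
  -- the values of `ω₀` at `x`.
  rw [add_add_add_comm, h5, zero_add]
  rfl

/-- The fundamental vector field of an element of the Lie algebra. -/
noncomputable def fundamentalField (ρ : LocallyFreeAction E F M S)
    (v : GroupLieAlgebra 𝓘(ℝ, F) S) : ρ.LeafwiseField where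
  toFun x := ⟨ρ.orbitDeriv x v, v, rfl⟩
  smooth _ := ρ.smooth_combination (a := fun _ => v) contMDiff_const.contMDiffAt

theorem canonicalForm_fundamentalField (v : GroupLieAlgebra 𝓘(ℝ, F) S) (x : M) :
    ρ.canonicalForm x ((ρ.fundamentalField v).toFun x) = v :=
  canonicalForm_orbitDeriv x v rfl

theorem fieldBracket_fundamentalField (v w : GroupLieAlgebra 𝓘(ℝ, F) S) (x : M) :
    (ρ.fieldBracket (ρ.fundamentalField v) (ρ.fundamentalField w)).toFun x =
      (ρ.fundamentalField ⁅v, w⁆).toFun x :=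
  Subtype.ext (ρ.mlieBracket_orbitDeriv_const v w x)

end LocallyFreeAction

end Leafwise

/-! ### Averaging leafwise forms to Lie algebra cochains -/

section Averaging

variable {E : Type*} [NormedAddCommGroup E] [NormedSpace ℝ E] [FiniteDimensional ℝ E]
  {F : Type*} [NormedAddCommGroup F] [NormedSpace ℝ F] [FiniteDimensional ℝ F]
  {M : Type*} [TopologicalSpace M] [ChartedSpace E M] [IsManifold 𝓘(ℝ, E) ∞ M]
  {S : Type*} [TopologicalSpace S] [ChartedSpace F S] [Group S] [LieGroup 𝓘(ℝ, F) ∞ S]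
  {V : Type*} [NormedAddCommGroup V] [NormedSpace ℝ V]

namespace LocallyFreeAction

variable {ρ : LocallyFreeAction E F M S}

/-- The derivative is the fibre component of the tangent map of `ξ` composed with the section `X`.
Continuity is all that is needed for it to have a mean. -/
theorem continuous_fieldDeriv (X : ρ.LeafwiseField) {ξ : M → V}
    (hξ : ContMDiff 𝓘(ℝ, E) 𝓘(ℝ, V) ∞ ξ) : Continuous (fieldDeriv X ξ) :=
  ((contMDiff_snd_tangentBundle_modelSpace V 𝓘(ℝ, V) (n := 0)).continuous.comp
    (hξ.continuous_tangentMap (by simp))).comp X.smooth.continuous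

/-- A leafwise form in the frame of the fundamental vector fields. -/
noncomputable def frameForm {p : ℕ} (η : ρ.LeafwiseForm V p) (x : M) :
    LieCochain (GroupLieAlgebra 𝓘(ℝ, F) S) V p :=
  (η.1 x).compLinearMap (ρ.canonicalForm x).symm.toLinearMap

/-- The coefficients of a leafwise form in the frame of the fundamental vector fields. -/
noncomputable def frameCoefficient {p : ℕ} (η : ρ.LeafwiseForm V p)
    (v : Fin p → GroupLieAlgebra 𝓘(ℝ, F) S) : C(M, V) :=
  ⟨fun x => frameForm η x v, (η.2 fun k => ρ.fundamentalField (v k)).continuous⟩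


theorem pullback_mem_cocycles (π : LieRep (GroupLieAlgebra 𝓘(ℝ, F) S) V) {p : ℕ}
    {φ : LieCochain (GroupLieAlgebra 𝓘(ℝ, F) S) V p} (hφ : φ ∈ lieCocycles π p) :
    ρ.pullback V p φ ∈ ρ.cocycles π p := by
  refine LinearMap.mem_ker.2 (funext fun X => funext fun x => ?_)
  rw [covariantDifferential_pullback, LinearMap.mem_ker.1 hφ]
  rfl

theorem pullback_mem_coboundaries (π : LieRep (GroupLieAlgebra 𝓘(ℝ, F) S) V) {p : ℕ}
    {φ : LieCochain (GroupLieAlgebra 𝓘(ℝ, F) S) V p} (hφ : φ ∈ lieCoboundaries π p) :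
    ρ.pullback V p φ ∈ ρ.coboundaries π p := by
  cases p with
  | zero =>
    obtain rfl : φ = 0 := hφ
    rw [map_zero]
    exact Submodule.zero_mem _
  | succ p =>
    obtain ⟨ψ, hψ⟩ := hφ
    refine ⟨ρ.pullback V p ψ, funext fun X => funext fun x => ?_⟩
    rw [covariantDifferential_pullback, hψ]
    rfl

variable [FiniteDimensional ℝ V] (m : ρ.InvariantMean)

/-- The mean of a leafwise form over an invariant mean. -/
noncomputable def averageCochain {p : ℕ} (η : ρ.LeafwiseForm V p) :
    LieCochain (GroupLieAlgebra 𝓘(ℝ, F) S) V p where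
  toFun v := m.vectorMean (frameCoefficient η v)
  map_update_add' v i a b := by
    rw [← map_add]
    congr 1
    ext x
    exact (frameForm η x).map_update_add v i a b
  map_update_smul' v i c a := by
    rw [← map_smul]
    congr 1
    ext x
    exact (frameForm η x).map_update_smul v i c a
  map_eq_zero_of_eq' v i j hv hij := by
    rw [← map_zero m.vectorMean]
    congr 1
    ext x
    exact (frameForm η x).map_eq_zero_of_eq v hv hij

theorem averageCochain_apply {p : ℕ} (η : ρ.LeafwiseForm V p)
    (v : Fin p → GroupLieAlgebra 𝓘(ℝ, F) S) :
    averageCochain m η v = m.vectorMean (frameCoefficient η v) := rfl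

/-- In the frame of fundamental fields the pullback has the constant coefficients `φ v`, and a mean
fixes constants. -/
theorem averageCochain_pullback {p : ℕ} (φ : LieCochain (GroupLieAlgebra 𝓘(ℝ, F) S) V p) :
    averageCochain m (ρ.pullback V p φ) = φ := by
  ext v
  rw [averageCochain_apply, ← m.vectorMean_const (φ v)]
  congr 1
  ext x
  exact congrArg φ (funext fun k => canonicalForm_fundamentalField (v k) x)

/-- Taking means of leafwise forms commutes with the differentials. -/
theorem vectorMean_covariantDifferential [CompactSpace M]
    (π : LieRep (GroupLieAlgebra 𝓘(ℝ, F) S) V) {p : ℕ} (ζ : ρ.LeafwiseForm V p)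
    (v : Fin (p + 1) → GroupLieAlgebra 𝓘(ℝ, F) S) {g : C(M, V)}
    (hg : ∀ x, g x = ρ.covariantDifferential π p ζ (fun i => ρ.fundamentalField (v i)) x) :
    m.vectorMean g = lieDifferential π p (averageCochain m ζ) v := by
  let X : Fin (p + 1) → ρ.LeafwiseField := fun i => ρ.fundamentalField (v i)
  have hξ : ∀ i : Fin (p + 1), ContMDiff 𝓘(ℝ, E) 𝓘(ℝ, V) ∞
      (ρ.formEval V p ζ fun k => X (i.succAbove k)) := fun i => ζ.2 _
  -- The three kinds of terms are separated as continuous functions, so that the mean can be applied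
  -- to each: derivatives `d`, representation terms `r`, bracket terms `b`.
  let d : Fin (p + 1) → C(M, V) := fun i => ⟨_, continuous_fieldDeriv (X i) (hξ i)⟩
  let r : Fin (p + 1) → C(M, V) := fun i =>
    ⟨fun x => π (v i) (frameCoefficient ζ (fun k => v (i.succAbove k)) x),
      (π (v i)).continuous_of_finiteDimensional.comp (ContinuousMap.continuous _)⟩
  let b : Fin (p + 1) → Fin (p + 1) → C(M, V) := fun i j =>
    frameCoefficient ζ fun k => Function.update v i ⁅v i, v j⁆ (j.succAbove k)
  have hsum : g = ∑ i : Fin (p + 1), (-1 : ℤ) ^ (i : ℕ) • (d i + r i) +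
      ∑ i : Fin (p + 1), ∑ j ∈ Finset.Ioi i, (-1 : ℤ) ^ (j : ℕ) • b i j := by
    ext x
    have h1 : ∀ i, covariantDeriv π (X i) (ρ.formEval V p ζ fun k => X (i.succAbove k)) x =
        d i x + r i x := by
      intro i
      change _ + π (ρ.canonicalForm x ((ρ.fundamentalField (v i)).toFun x)) _ = _
      rw [canonicalForm_fundamentalField]
      rfl
    have h2 : ∀ i j : Fin (p + 1), ρ.formEval V p ζ
        (fun k => Function.update X i (ρ.fieldBracket (X i) (X j)) (j.succAbove k)) x =
        b i j x := by
      intro i j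
      refine congrArg (ζ.1 x) (funext fun k => ?_)
      by_cases h : j.succAbove k = i
      · simp only [h, Function.update_self]
        exact fieldBracket_fundamentalField (v i) (v j) x
      · simp only [Function.update_of_ne h]
        rfl
    rw [hg]
    change koszul ρ.fieldBracket (covariantDeriv π) (ρ.formEval V p ζ) X x = _
    simp only [koszul, Pi.add_apply, Finset.sum_apply, Pi.smul_apply, h1, h2,
      ContinuousMap.add_apply, ContinuousMap.sum_apply, ContinuousMap.smul_apply]
  -- Invariance of the mean enters here: the derivative terms disappear. For the other two kinds
  -- linearity suffices.
  have hd : ∀ i, m.vectorMean (d i) = 0 := fun i =>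
    m.vectorMean_eq_zero_of_eq_deriv (hξ i) (v i) fun x => rfl
  have hr : ∀ i, m.vectorMean (r i) =
      π (v i) (averageCochain m ζ fun k => v (i.succAbove k)) := fun i =>
    m.vectorMean_map (π (v i)) _ fun x => rfl
  rw [hsum]
  simp only [map_add, map_sum, map_zsmul, hd, hr, zero_add]
  rfl

/-- Averaging inverts the pullback and commutes with the differentials, so a primitive `ζ` of `ω₀^*
φ` averages to a primitive of `φ`. In degree `0` only injectivity of the pullback on cochains is
used. -/
theorem mem_lieCoboundaries_of_pullback [CompactSpace M] (m : ρ.InvariantMean)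
    (π : LieRep (GroupLieAlgebra 𝓘(ℝ, F) S) V) {p : ℕ}
    {φ : LieCochain (GroupLieAlgebra 𝓘(ℝ, F) S) V p}
    (hφ : ρ.pullback V p φ ∈ ρ.coboundaries π p) : φ ∈ lieCoboundaries π p := by
  have hA := averageCochain_pullback m φ
  cases p with
  | zero =>
    have h0 : ρ.pullback V 0 φ = ρ.pullback V 0 0 := Eq.trans hφ (map_zero _).symm
    rw [h0, averageCochain_pullback] at hA
    exact hA.symm
  | succ p =>
    obtain ⟨ζ, hζ⟩ := hφ
    refine ⟨averageCochain m ζ, funext fun v => ?_⟩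
    rw [← vectorMean_covariantDifferential m π ζ v
      (g := frameCoefficient (ρ.pullback V (p + 1) φ) v) fun x => ?_]
    · exact congrArg (fun ψ : LieCochain _ V (p + 1) => ψ v) hA
    · rw [hζ]
      rfl

end LocallyFreeAction

end Averaging

end LeafwiseCohomology

/-! ### The induced map on cohomology and its injectivity -/

theorem proposition1p2
    {E : Type*} [NormedAddCommGroup E] [NormedSpace ℝ E] [FiniteDimensional ℝ E]
    {M : Type*} [TopologicalSpace M] [ChartedSpace E M] [IsManifold 𝓘(ℝ, E) ∞ M]
    [T2Space M] [CompactSpace M] [Nonempty M]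
    {F : Type*} [NormedAddCommGroup F] [NormedSpace ℝ F] [FiniteDimensional ℝ F]
    {S : Type*} [TopologicalSpace S] [ChartedSpace F S] [Group S] [LieGroup 𝓘(ℝ, F) ∞ S]
    [ConnectedSpace S] [SimplyConnectedSpace S] [Group.IsSolvable S]
    (ρ : LeafwiseCohomology.LocallyFreeAction E F M S)
    {V : Type*} [NormedAddCommGroup V] [NormedSpace ℝ V] [FiniteDimensional ℝ V]
    (π : LeafwiseCohomology.LieRep (GroupLieAlgebra 𝓘(ℝ, F) S) V) (p : ℕ) :
    ∃ f : LeafwiseCohomology.LieCohomology π p →ₗ[ℝ] ρ.Cohomology π p,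
      (∀ z : LeafwiseCohomology.lieCocycles π p, ∃ h : ρ.pullback V p z ∈ ρ.cocycles π p,
        f (Submodule.Quotient.mk z) = Submodule.Quotient.mk ⟨ρ.pullback V p z, h⟩) ∧
      Function.Injective f := by
  obtain ⟨m⟩ := ρ.toSmoothRightAction.nonempty_invariantMean
  let f₀ : LeafwiseCohomology.lieCocycles π p →ₗ[ℝ] ρ.cocycles π p :=
    (ρ.pullback V p).restrict fun _ =>
      LeafwiseCohomology.LocallyFreeAction.pullback_mem_cocycles π
  refine ⟨Submodule.mapQ _ _ f₀ fun z hz =>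
    LeafwiseCohomology.LocallyFreeAction.pullback_mem_coboundaries π hz, fun z =>
    ⟨LeafwiseCohomology.LocallyFreeAction.pullback_mem_cocycles π z.2, rfl⟩, ?_⟩
  refine (injective_iff_map_eq_zero _).2 fun c hc => ?_
  obtain ⟨z, rfl⟩ := Submodule.Quotient.mk_surjective _ c
  have hz : f₀ z ∈ (ρ.coboundaries π p).submoduleOf (ρ.cocycles π p) :=
    (Submodule.Quotient.mk_eq_zero _).1 hc
  exact (Submodule.Quotient.mk_eq_zero _).2
    (LeafwiseCohomology.LocallyFreeAction.mem_lieCoboundaries_of_pullback m π hz)
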